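/- Let $(M,g)$ be a finite-dimensional smooth Lorentzian manifold, i.e. $g$ is a smooth semi-Riemannian metric of signature $(+,\dots,+,-)$, and let $\nabla$ be its Levi-Civita connection. Let $f:\tilde M\to M$ be a smooth immersed submanifold, where $T_p\tilde M$ is identified with its image under $df_p$ in $T_{f(p)}M$. Assume that $2\le\dim\tilde M\le\dim M$ and that $\tilde M$ is timelike, i.e. the tensor field induced by $g$ on $\tilde M$ has signature $(+,\dots,+,-)$ at every point. Define the second fundamental form of $\tilde M$, with values in the quotient spaces $T_{f(p)}M/T_p\tilde M$, by $\Pi(X,Y)=[\nabla_XY]$ for (globally or locally defined) smooth vector fields $X,Y$ tangent to $\tilde M$. Then the following two conditions are equivalent. (i) $\tilde M$ is totally umbilic: there is a smooth vector field $Z$ along $\tilde M$ (a section of $f^*TM$, not necessarily tangent to $\tilde M$) such that $\Pi(X,Y)=[g(X,Y)\,Z]$ for all smooth vector fields $X,Y$ tangent to $\tilde M$. (ii) $\tilde M$ is a photon surface: every lightlike geodesic that starts tangent to $\tilde M$ remains within $\tilde M$ for some parameter interval around the starting point. Explicitly: let $\gamma:(a,b)\to M$ be an (affinely parametrized) geodesic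 of $\nabla$ with $g(\dot\gamma,\dot\gamma)=0$, and let $t_0\in(a,b)$, $q\in\tilde M$ and $v\in T_q\tilde M$ satisfy $\gamma(t_0)=f(q)$ and $\dot\gamma(t_0)=df_q(v)$. Then there are $\varepsilon>0$ and a continuous curve $c:(t_0-\varepsilon,t_0+\varepsilon)\to\tilde M$ with $c(t_0)=q$ and $f(c(t))=\gamma(t)$ for all $t$ in this interval. (If $f$ is an embedding, this just says that $\gamma(t)\in f(\tilde M)$ for all $t$ near $t_0$.) -/

import Mathlib

open scoped Manifold ContDiff

noncomputable section

namespace SemiRiem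

/-- A bilinear form on a real vector space has Lorentzian signature `(+, …, +, -)`:
it has a pseudo-orthonormal basis with exactly one (the last) basis vector of square `-1`. -/
def IsLorentzForm {V : Type*} [AddCommGroup V] [Module ℝ V]
    (B : LinearMap.BilinForm ℝ V) : Prop :=
  ∃ (m : ℕ) (e : Module.Basis (Fin (m + 1)) ℝ V), ∀ i j : Fin (m + 1),
    B (e i) (e j) = if i = j then (if i = Fin.last m then -1 else 1) else 0

section Metric

variable (E : Type*) [NormedAddCommGroup E] [NormedSpace ℝ E]
  (M : Type*) [TopologicalSpace M] [ChartedSpace E M] [IsManifold 𝓘(ℝ, E) ∞ M]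

/-- A smooth semi-Riemannian metric on a manifold `M` modelled on `E`: a smooth field of symmetric
non-degenerate bilinear forms on the tangent spaces. -/
structure SemiRiemannianMetric where
  /-- The bilinear form on the tangent space at `x`. -/
  val (x : M) : TangentSpace 𝓘(ℝ, E) x →L[ℝ] TangentSpace 𝓘(ℝ, E) x →L[ℝ] ℝ
  symm (x : M) (v w : TangentSpace 𝓘(ℝ, E) x) : val x v w = val x w v
  nondegenerate (x : M) (v : TangentSpace 𝓘(ℝ, E) x) (hv : ∀ w, val x v w = 0) : v = 0
  contMDiff : ContMDiff 𝓘(ℝ, E) (𝓘(ℝ, E).prod 𝓘(ℝ, E →L[ℝ] E →L[ℝ] ℝ)) ∞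
    (fun x ↦ Bundle.TotalSpace.mk' (E →L[ℝ] E →L[ℝ] ℝ)
      (E := fun x : M ↦ TangentSpace 𝓘(ℝ, E) x →L[ℝ] TangentSpace 𝓘(ℝ, E) x →L[ℝ] ℝ) x (val x))

end Metric

section Connection

variable {E : Type*} [NormedAddCommGroup E] [NormedSpace ℝ E]
  {M : Type*} [TopologicalSpace M] [ChartedSpace E M] [IsManifold 𝓘(ℝ, E) ∞ M]

/-- The metric at `x` as an algebraic bilinear form. -/
def SemiRiemannianMetric.bilinForm (g : SemiRiemannianMetric E M) (x : M) :
    LinearMap.BilinForm ℝ (TangentSpace 𝓘(ℝ, E) x) :=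
  (g.val x).toLinearMap₁₂

/-- A semi-Riemannian metric is Lorentzian if it has signature `(+, …, +, -)` everywhere. -/
def SemiRiemannianMetric.IsLorentzian (g : SemiRiemannianMetric E M) : Prop :=
  ∀ x : M, IsLorentzForm (g.bilinForm x)

/-- The metric expressed in the preferred chart at `x`: the matrix `(g_{ij})` as a function of the
coordinates `y`, i.e. the pull-back of `g` under the inverse of the chart. -/
def SemiRiemannianMetric.inChart (g : SemiRiemannianMetric E M) (x : M) (y : E) :
    E →L[ℝ] E →L[ℝ] ℝ :=
  let B : E →L[ℝ] E →L[ℝ] ℝ := g.val ((extChartAt 𝓘(ℝ, E) x).symm y)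
  let A : E →L[ℝ] E := mfderiv 𝓘(ℝ, E) 𝓘(ℝ, E) (extChartAt 𝓘(ℝ, E) x).symm y
  B.bilinearComp A A

/-- The Christoffel symbols of the first kind at `x`, in the preferred chart at `x`, as the linear
form `w ↦ (∂_u g(v, w) + ∂_v g(u, w) - ∂_w g(u, v)) / 2`. -/
def SemiRiemannianMetric.christoffelLower (g : SemiRiemannianMetric E M) (x : M) (u v : E) :
    E →ₗ[ℝ] ℝ where
  toFun w :=
    (fderiv ℝ (g.inChart x) (extChartAt 𝓘(ℝ, E) x x) u v w
      + fderiv ℝ (g.inChart x) (extChartAt 𝓘(ℝ, E) x x) v u w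
      - fderiv ℝ (g.inChart x) (extChartAt 𝓘(ℝ, E) x x) w u v) / 2
  map_add' w w' := by simp; ring
  map_smul' c w := by simp; ring

/-- The metric at `x` as a bilinear form on the model space `E`, which is `T_x M` by definition
(the identification being the differential at `x` of the preferred chart at `x`). -/
def SemiRiemannianMetric.modelForm (g : SemiRiemannianMetric E M) (x : M) :
    LinearMap.BilinForm ℝ E :=
  g.bilinForm x

theorem SemiRiemannianMetric.modelForm_nondegenerate (g : SemiRiemannianMetric E M) (x : M) :
    (g.modelForm x).Nondegenerate :=
  ⟨fun v hv ↦ g.nondegenerate x v hv,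
    fun v hv ↦ g.nondegenerate x v fun w ↦ (g.symm x v w).trans (hv w)⟩

/-- The Christoffel symbols of the second kind of `g` at `x` in the preferred chart at `x`:
the vector `Γ(u, v)` with `g(Γ(u, v), w) = (∂_u g(v, w) + ∂_v g(u, w) - ∂_w g(u, v)) / 2`
for all `w`. -/
def SemiRiemannianMetric.christoffel [FiniteDimensional ℝ E] (g : SemiRiemannianMetric E M)
    (x : M) (u v : E) : E :=
  ((g.modelForm x).toDual (g.modelForm_nondegenerate x)).symm (g.christoffelLower x u v)

variable {E' : Type*} [NormedAddCommGroup E'] [NormedSpace ℝ E']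
  {N : Type*} [TopologicalSpace N] [ChartedSpace E' N]

/-- The Levi-Civita covariant derivative of `g` along a map `f : N → M`: for a vector field `Y`
along `f` and `v ∈ T_p N`, this is `∇_v Y ∈ T_{f p} M`, given in the preferred chart `φ` at `f p`
by the classical formula `(∇_v Y)^k = v(Y^k) + Γ^k_{ij} (df v)^i Y^j`, where
`Y^k` are the components of `Y` with respect to `φ`. -/
def SemiRiemannianMetric.covDerivAlong [FiniteDimensional ℝ E] (g : SemiRiemannianMetric E M)
    (f : N → M) (Y : ∀ p : N, TangentSpace 𝓘(ℝ, E) (f p)) (p : N) (v : TangentSpace 𝓘(ℝ, E') p) :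
    TangentSpace 𝓘(ℝ, E) (f p) :=
  let Yφ : N → E := fun q ↦ mvfderiv 𝓘(ℝ, E) (extChartAt 𝓘(ℝ, E) (f p)) (f q) (Y q)
  let Γ : E → E → E := g.christoffel (f p)
  (mvfderiv 𝓘(ℝ, E') Yφ p v + Γ (mfderiv 𝓘(ℝ, E') 𝓘(ℝ, E) f p v) (Y p) : E)

end Connection

section Geodesic

variable {E : Type*} [NormedAddCommGroup E] [NormedSpace ℝ E]
  {M : Type*} [TopologicalSpace M] [ChartedSpace E M]

/-- The velocity `γ'(t)` of a curve. -/
def velocity (γ : ℝ → M) (t : ℝ) : TangentSpace 𝓘(ℝ, E) (γ t) :=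
  mfderiv 𝓘(ℝ, ℝ) 𝓘(ℝ, E) γ t (1 : ℝ)

variable [IsManifold 𝓘(ℝ, E) ∞ M] [FiniteDimensional ℝ E]

/-- `γ` restricted to the open interval `(a, b)` is an (affinely parametrized) geodesic:
it is `C²` and satisfies `∇_{γ'} γ' = 0`. -/
def SemiRiemannianMetric.IsGeodesicOn (g : SemiRiemannianMetric E M) (γ : ℝ → M) (a b : ℝ) :
    Prop :=
  ContMDiffOn 𝓘(ℝ, ℝ) 𝓘(ℝ, E) 2 γ (Set.Ioo a b) ∧
    ∀ t ∈ Set.Ioo a b, g.covDerivAlong γ (velocity (E := E) γ) t (1 : ℝ) = 0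

/-- `γ` restricted to the open interval `(a, b)` is lightlike: `g(γ', γ') = 0`. -/
def SemiRiemannianMetric.IsLightlikeOn (g : SemiRiemannianMetric E M) (γ : ℝ → M) (a b : ℝ) :
    Prop :=
  ∀ t ∈ Set.Ioo a b, g.val (γ t) (velocity γ t) (velocity γ t) = 0

end Geodesic

section Submanifold

variable {E : Type*} [NormedAddCommGroup E] [NormedSpace ℝ E]
  {M : Type*} [TopologicalSpace M] [ChartedSpace E M] [IsManifold 𝓘(ℝ, E) ∞ M]
  {E' : Type*} [NormedAddCommGroup E'] [NormedSpace ℝ E']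
  {N : Type*} [TopologicalSpace N] [ChartedSpace E' N]

/-- The first fundamental form (the tensor field induced by `g`) at `p ∈ N`:
`(u, v) ↦ g(df u, df v)`. -/
def SemiRiemannianMetric.induced (g : SemiRiemannianMetric E M) (f : N → M) (p : N) :
    LinearMap.BilinForm ℝ (TangentSpace 𝓘(ℝ, E') p) :=
  (g.bilinForm (f p)).comp (mfderiv 𝓘(ℝ, E') 𝓘(ℝ, E) f p).toLinearMap
    (mfderiv 𝓘(ℝ, E') 𝓘(ℝ, E) f p).toLinearMap

/-- The immersed submanifold `f : N → M` is timelike: the induced tensor field is (non-degenerate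
and) of Lorentzian signature at every point. -/
def SemiRiemannianMetric.IsTimelike (g : SemiRiemannianMetric E M) (f : N → M) : Prop :=
  ∀ p : N, IsLorentzForm (g.induced (E' := E') f p)

/-- The image of `T_p N` in `T_{f p} M`, i.e. the tangent space of the immersed submanifold. -/
def tangentImage (E : Type*) [NormedAddCommGroup E] [NormedSpace ℝ E] {M : Type*}
    [TopologicalSpace M] [ChartedSpace E M] (E' : Type*) [NormedAddCommGroup E']
    [NormedSpace ℝ E'] {N : Type*} [TopologicalSpace N] [ChartedSpace E' N]
    (f : N → M) (p : N) : Submodule ℝ (TangentSpace 𝓘(ℝ, E) (f p)) :=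
  (mfderiv 𝓘(ℝ, E') 𝓘(ℝ, E) f p).range

variable [FiniteDimensional ℝ E]

/-- The second fundamental form `Π(X, Y) = [∇_X Y]` at `p`, with values in the quotient
`T_{f p} M ⧸ T_p N`, for vector fields `X`, `Y` on `N` (regarded, via `df`, as vector fields tangent
to the immersed submanifold). -/
def SemiRiemannianMetric.secondFundamentalForm (g : SemiRiemannianMetric E M) (f : N → M)
    (X Y : ∀ p : N, TangentSpace 𝓘(ℝ, E') p) (p : N) :
    TangentSpace 𝓘(ℝ, E) (f p) ⧸ tangentImage E E' f p :=
  Submodule.Quotient.mk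
    (g.covDerivAlong f (fun q ↦ mfderiv 𝓘(ℝ, E') 𝓘(ℝ, E) f q (Y q)) p (X p))

variable [IsManifold 𝓘(ℝ, E') ∞ N]

/-- The immersed submanifold `f : N → M` is totally umbilic: there is a smooth vector field `Z`
along it with `Π(X, Y) = [g(X, Y) Z]` for all smooth vector fields `X`, `Y` tangent to it
(globally defined or defined on an open subset only). -/
def SemiRiemannianMetric.IsTotallyUmbilic (g : SemiRiemannianMetric E M) (f : N → M) : Prop :=
  ∃ Z : ∀ p : N, TangentSpace 𝓘(ℝ, E) (f p),
    ContMDiff 𝓘(ℝ, E') 𝓘(ℝ, E).tangent ∞ (fun p ↦ (⟨f p, Z p⟩ : TangentBundle 𝓘(ℝ, E) M)) ∧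
    ∀ (U : Set N) (X Y : ∀ p : N, TangentSpace 𝓘(ℝ, E') p), IsOpen U →
      ContMDiffOn 𝓘(ℝ, E') 𝓘(ℝ, E').tangent ∞
        (fun p ↦ (⟨p, X p⟩ : TangentBundle 𝓘(ℝ, E') N)) U →
      ContMDiffOn 𝓘(ℝ, E') 𝓘(ℝ, E').tangent ∞
        (fun p ↦ (⟨p, Y p⟩ : TangentBundle 𝓘(ℝ, E') N)) U →
      ∀ p ∈ U, g.secondFundamentalForm f X Y p =
        Submodule.Quotient.mk (g.induced f p (X p) (Y p) • Z p)

/-- Every lightlike geodesic that starts tangent to the immersed submanifold `f : N → M` remains in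
it for some parameter interval around the starting point. Here `γ : (a, b) → M` starts (at the
parameter `t₀`) tangent to the submanifold at `q ∈ N` if `γ(t₀) = f q` and `γ'(t₀) = df v` for some
`v ∈ T_q N`; it remains in the submanifold for `|t - t₀| < ε` if there it is the image of a
continuous curve in `N` through `q` (if `f` is a topological embedding, this says that
`γ(t)` lies in the subset `f(N)` of `M` for all `t` near `t₀`). -/
def SemiRiemannianMetric.IsPhotonSurface (g : SemiRiemannianMetric E M) (f : N → M) : Prop :=
  ∀ (γ : ℝ → M) (a b : ℝ), g.IsGeodesicOn γ a b → g.IsLightlikeOn γ a b →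
    ∀ t₀ ∈ Set.Ioo a b, ∀ (q : N) (v : TangentSpace 𝓘(ℝ, E') q),
      (⟨f q, mfderiv 𝓘(ℝ, E') 𝓘(ℝ, E) f q v⟩ : TangentBundle 𝓘(ℝ, E) M)
        = ⟨γ t₀, velocity γ t₀⟩ →
      ∃ ε > 0, ∃ c : ℝ → N, ContinuousOn c (Set.Ioo (t₀ - ε) (t₀ + ε)) ∧ c t₀ = q ∧
        ∀ t ∈ Set.Ioo (t₀ - ε) (t₀ + ε), f (c t) = γ t

end Submanifold

end SemiRiem

end

/-! Take charts in which the immersion is a linear inclusion `ι` with left inverse `π`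
(`exists_isSlice`). The projection `transversal ι π`, that is `1 - ι π`, has the tangent space as
kernel and so represents the quotient by it. For fields tangent to the slice, differentiating
components gives tangent vectors again, so Π(X, Y) is the transversal part of Γ(X, Y). Umbilicity at
a point thus says that this bilinear map is the induced metric times a fixed vector
(`IsSlice.isUmbilicAt_iff`).

From photon surface to umbilic: a null geodesic issuing from a tangent null vector ξ stays in the
slice, so its transversal coordinates vanish identically; their second derivative gives that the
transversal part of Γ(ξ, ξ) is zero (`IsSlice.transversal_christ_eq_zero`). A symmetric bilinear map
vanishing on the null cone of a Lorentz form is a multiple of that form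
(`IsLorentzForm.exists_eq_smul`). Requiring the resulting vector to be normal makes it unique, hence
given locally by a smooth formula.

From umbilic to photon surface: along a null geodesic, the transversal acceleration equals a smooth
function of position and velocity that vanishes at states tangent to the slice. The transversal
coordinates z therefore satisfy |z''| ≤ K |(z, z')| with zero initial data, and Grönwall gives z = 0
(`eventually_transversal_eq_zero`).

The covariant derivative is defined through the preferred chart at each point, while the argument
lives in slice charts. The transformation law of the Christoffel symbols (`fderiv_christ_pullback`)
bridges the two, through `SemiRiemannianMetric.chartDeriv_covDerivAlong`. -/

noncomputable section

namespace SemiRiem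

open Set Filter Topology

set_option maxSynthPendingDepth 3

open Set Filter Topology

/-! ### Christoffel symbols of a metric on a vector space -/

section Christoffel

variable {E : Type*} [NormedAddCommGroup E] [NormedSpace ℝ E]

/-- The combination `(D(u; v, w) + D(v; u, w) - D(w; u, v)) / 2` of the derivative `D` of a metric
on a vector space. -/
def koszul (D : E →L[ℝ] E →L[ℝ] E →L[ℝ] ℝ) : E →L[ℝ] E →L[ℝ] E →L[ℝ] ℝ :=
  (1 / 2 : ℝ) • (D + D.flip -
    (ContinuousLinearMap.flipₗᵢ ℝ E E ℝ).toContinuousLinearEquiv.toContinuousLinearMap ∘L D.flip)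

theorem koszul_apply (D : E →L[ℝ] E →L[ℝ] E →L[ℝ] ℝ) (u v w : E) :
    koszul D u v w = (D u v w + D v u w - D w u v) / 2 := by
  simp [koszul]
  ring

/-- The Christoffel symbols of the second kind of a field `G` of bilinear forms on a vector
space. -/
def christ (G : E → E →L[ℝ] E →L[ℝ] ℝ) (y : E) : E →L[ℝ] E →L[ℝ] E :=
  (ContinuousLinearMap.compL ℝ E (E →L[ℝ] ℝ) E (G y).inverse) ∘L koszul (fderiv ℝ G y)

variable {G : E → E →L[ℝ] E →L[ℝ] ℝ}

theorem apply_christ {y : E} (hG : (G y).IsInvertible) (u v w : E) :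
    G y (christ G y u v) w = koszul (fderiv ℝ G y) u v w := by
  have : G y (christ G y u v) = koszul (fderiv ℝ G y) u v := by
    simp [christ, hG.self_apply_inverse]
  rw [this]

/-- Injectivity suffices because `E` and its dual have the same finite dimension. -/
theorem isInvertible_of_nondegenerate [FiniteDimensional ℝ E] {B : E →L[ℝ] E →L[ℝ] ℝ}
    (hB : ∀ v, (∀ w, B v w = 0) → v = 0) : B.IsInvertible := by
  have hinj : Function.Injective B.toLinearMap := by
    rw [← LinearMap.ker_eq_bot, LinearMap.ker_eq_bot']
    intro v hv
    exact hB v fun w ↦ by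
      have : B v = 0 := hv
      simp [this]
  have hdim : Module.finrank ℝ E = Module.finrank ℝ (E →L[ℝ] ℝ) := by
    rw [← (LinearMap.toContinuousLinearMap (𝕜 := ℝ) (E := E) (F' := ℝ)).finrank_eq]
    exact Subspace.dual_finrank_eq.symm
  exact ⟨(LinearEquiv.ofInjectiveOfFinrankEq B.toLinearMap hinj hdim).toContinuousLinearEquiv,
    by ext; rfl⟩

theorem fderiv_apply_apply {y : E} (hG : DifferentiableAt ℝ G y) (u v w : E) :
    fderiv ℝ G y u v w = fderiv ℝ (fun z ↦ G z v w) y u := by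
  have h := (hG.hasFDerivAt.clm_apply (hasFDerivAt_const v y)).clm_apply (hasFDerivAt_const w y)
  rw [h.fderiv]
  simp

theorem christ_symm {y : E} (hG : DifferentiableAt ℝ G y) (hinv : (G y).IsInvertible)
    (hsymm : ∀ z a b, G z a b = G z b a) (u v : E) : christ G y u v = christ G y v u := by
  apply hinv.injective
  ext w
  rw [apply_christ hinv, apply_christ hinv, koszul_apply, koszul_apply,
    fderiv_apply_apply hG w u v, fderiv_apply_apply hG w v u]
  simp only [hsymm _ u v]
  ring

theorem contDiffOn_christ [FiniteDimensional ℝ E] {Ω : Set E} (hΩ : IsOpen Ω)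
    (hG : ContDiffOn ℝ ∞ G Ω) (hinv : ∀ y ∈ Ω, (G y).IsInvertible) :
    ContDiffOn ℝ ∞ (christ G) Ω := by
  have : CompleteSpace E := FiniteDimensional.complete ℝ E
  have hD : ContDiffOn ℝ ∞ (fderiv ℝ G) Ω := hG.fderiv_of_isOpen hΩ (by simp)
  have hK : ∀ u v : E, ContDiffOn ℝ ∞ (fun y ↦ koszul (fderiv ℝ G y) u v) Ω := by
    intro u v
    rw [contDiffOn_clm_apply]
    intro w
    simp only [koszul_apply]
    have h : ∀ a b c : E, ContDiffOn ℝ ∞ (fun y ↦ fderiv ℝ G y a b c) Ω := fun a b c ↦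
      ((hD.clm_apply contDiffOn_const).clm_apply contDiffOn_const).clm_apply contDiffOn_const
    exact (((h u v w).add (h v u w)).sub (h w u v)).div_const 2
  have hI : ContDiffOn ℝ ∞ (fun y ↦ (G y).inverse) Ω := fun y hy ↦
    ((hinv y hy).contDiffAt_map_inverse (n := ∞)).comp_contDiffWithinAt y (hG y hy)
  rw [contDiffOn_clm_apply]
  intro u
  rw [contDiffOn_clm_apply]
  intro v
  exact hI.clm_apply (hK u v)

/-- Product and chain rule. The two terms with second derivatives of `τ` produce the inhomogeneous
term in the transformation law of the Christoffel symbols. -/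
theorem fderiv_pullback_apply {G G' : E → E →L[ℝ] E →L[ℝ] ℝ} {τ : E → E} {y : E}
    (hτ : ContDiffAt ℝ 2 τ y)
    (hG : DifferentiableAt ℝ G (τ y))
    (hGG' : G' =ᶠ[𝓝 y] fun z ↦ (G (τ z)).bilinearComp (fderiv ℝ τ z) (fderiv ℝ τ z))
    (u v w : E) :
    fderiv ℝ G' y u v w = fderiv ℝ G (τ y) (fderiv ℝ τ y u) (fderiv ℝ τ y v) (fderiv ℝ τ y w)
      + G (τ y) (fderiv ℝ (fderiv ℝ τ) y u v) (fderiv ℝ τ y w)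
      + G (τ y) (fderiv ℝ τ y v) (fderiv ℝ (fderiv ℝ τ) y u w) := by
  have hτ1 : DifferentiableAt ℝ τ y := hτ.differentiableAt (by norm_num)
  have hA : DifferentiableAt ℝ (fderiv ℝ τ) y :=
    (hτ.fderiv_right (m := 1) (by norm_num)).differentiableAt (by norm_num)
  have hGτ : HasFDerivAt (fun z ↦ G (τ z)) ((fderiv ℝ G (τ y)).comp (fderiv ℝ τ y)) y :=
    hG.hasFDerivAt.comp y hτ1.hasFDerivAt
  have hAv : ∀ v, HasFDerivAt (fun z ↦ fderiv ℝ τ z v)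
      ((fderiv ℝ (fderiv ℝ τ) y).flip v) y := fun v ↦ by
    simpa using hA.hasFDerivAt.clm_apply (hasFDerivAt_const v y)
  have hmain := (hGτ.clm_apply (hAv v)).clm_apply (hAv w)
  have hG' : DifferentiableAt ℝ G' y := by
    refine DifferentiableAt.congr_of_eventuallyEq ?_ hGG'
    have : (fun z ↦ (G (τ z)).bilinearComp (fderiv ℝ τ z) (fderiv ℝ τ z)) =
        fun z ↦ (((fderiv ℝ τ z).precomp ℝ) ∘L (G (τ z)) ∘L (fderiv ℝ τ z)) := by
      ext z v w
      simp
    rw [this]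
    have hp : DifferentiableAt ℝ (fun z ↦ (fderiv ℝ τ z).precomp ℝ) y :=
      ((ContinuousLinearMap.compL ℝ E E ℝ).flip).differentiableAt.comp y hA
    exact hp.clm_comp (hGτ.differentiableAt.clm_comp hA)
  rw [fderiv_apply_apply hG', Filter.EventuallyEq.fderiv_eq (f := fun z ↦ G (τ z) (fderiv ℝ τ z v)
    (fderiv ℝ τ z w)) (hGG'.mono fun z hz ↦ by simp [hz]), hmain.fderiv]
  simp
  ring

/-- The transformation law of the Christoffel symbols under a change of coordinates. -/
theorem fderiv_christ_pullback {G G' : E → E →L[ℝ] E →L[ℝ] ℝ} {τ : E → E} {y : E}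
    (hτ : ContDiffAt ℝ 2 τ y) (hA : Function.Surjective (fderiv ℝ τ y))
    (hG : DifferentiableAt ℝ G (τ y)) (hsymm : ∀ v w, G (τ y) v w = G (τ y) w v)
    (hinv : (G (τ y)).IsInvertible) (hinv' : (G' y).IsInvertible)
    (hGG' : G' =ᶠ[𝓝 y] fun z ↦ (G (τ z)).bilinearComp (fderiv ℝ τ z) (fderiv ℝ τ z))
    (u v : E) :
    fderiv ℝ τ y (christ G' y u v) =
      christ G (τ y) (fderiv ℝ τ y u) (fderiv ℝ τ y v) + fderiv ℝ (fderiv ℝ τ) y u v := by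
  have hs : ∀ a b, fderiv ℝ (fderiv ℝ τ) y a b = fderiv ℝ (fderiv ℝ τ) y b a :=
    hτ.isSymmSndFDerivAt (by simp)
  apply hinv.injective
  ext w'
  obtain ⟨w, rfl⟩ := hA w'
  have h1 : G (τ y) (fderiv ℝ τ y (christ G' y u v)) (fderiv ℝ τ y w) =
      G' y (christ G' y u v) w := by
    rw [hGG'.eq_of_nhds]
    simp
  rw [h1, apply_christ hinv', koszul_apply, map_add, add_apply,
    apply_christ hinv, koszul_apply]
  simp only [fderiv_pullback_apply hτ hG hGG']
  -- Of the six terms with a second derivative of `τ`, symmetry cancels four and leaves two equal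
  -- ones, whose half is the inhomogeneous term.
  rw [hs v u, hs w u, hs w v, hsymm (fderiv ℝ (fderiv ℝ τ) y u w)]
  ring

/-- `G(x', x')` is constant along a geodesic: its derivative vanishes. -/
theorem hasDerivAt_energy {x w : ℝ → E} {t : ℝ} (hG : DifferentiableAt ℝ G (x t))
    (hsymm : ∀ v w, G (x t) v w = G (x t) w v) (hinv : (G (x t)).IsInvertible)
    (hx : HasDerivAt x (w t) t) (hw : HasDerivAt w (-christ G (x t) (w t) (w t)) t) :
    HasDerivAt (fun s ↦ G (x s) (w s) (w s)) 0 t := by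
  have h1 : HasDerivAt (fun s ↦ G (x s)) (fderiv ℝ G (x t) (w t)) t :=
    hG.hasFDerivAt.comp_hasDerivAt t hx
  have h2 := (h1.clm_apply hw).clm_apply hw
  convert! h2 using 1
  -- With all arguments equal to `w t`, the Koszul expression is half the derivative of `G`; the two
  -- acceleration terms each remove one half.
  simp only [map_neg, add_apply, neg_apply]
  rw [hsymm (w t), apply_christ hinv, koszul_apply]
  ring

end Christoffel

/-! ### Lorentz forms and their null vectors -/

section LorentzForm

variable {V W : Type*} [AddCommGroup V] [Module ℝ V] [AddCommGroup W] [Module ℝ W]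
  {B : LinearMap.BilinForm ℝ V}

/-- Pairing with a vector of the pseudo-orthonormal basis reads off the corresponding coordinate up
to sign. -/
theorem IsLorentzForm.eq_zero (hB : IsLorentzForm B) {v : V} (hv : ∀ w, B v w = 0) : v = 0 := by
  obtain ⟨m, e, he⟩ := hB
  rw [← e.repr.map_eq_zero_iff]
  ext j
  have h := hv (e j)
  rw [← e.sum_repr v] at h
  simp only [map_sum, map_smul, LinearMap.sum_apply, LinearMap.smul_apply, he, smul_eq_mul,
    mul_ite, mul_zero, Finset.sum_ite_eq', Finset.mem_univ, if_true] at h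
  split_ifs at h <;> simpa using h

theorem IsLorentzForm.exists_apply_self_ne_zero (hB : IsLorentzForm B) : ∃ v, B v v ≠ 0 := by
  obtain ⟨m, e, he⟩ := hB
  exact ⟨e (Fin.last m), by simp [he]⟩

/-- A symmetric bilinear map that vanishes on the null vectors of a Lorentz form is a multiple of
this form. -/
theorem IsLorentzForm.exists_eq_smul (hB : IsLorentzForm B) (β : V →ₗ[ℝ] V →ₗ[ℝ] W)
    (hβ : ∀ u v, β u v = β v u) (hnull : ∀ v, B v v = 0 → β v v = 0) :
    ∃ ζ : W, ∀ u v, β u v = B u v • ζ := by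
  obtain ⟨m, e, he⟩ := hB
  have hll : B (e (Fin.last m)) (e (Fin.last m)) = -1 := by simp [he]
  have hii : ∀ i, i ≠ Fin.last m → B (e i) (e i) = 1 := fun i hi ↦ by simp [he, hi]
  have hij : ∀ i j, i ≠ j → B (e i) (e j) = 0 := fun i j h ↦ by simp [he, h]
  have key : ∀ i, i ≠ Fin.last m → β (e i) (e (Fin.last m)) = 0 ∧
      β (e i) (e i) = - β (e (Fin.last m)) (e (Fin.last m)) := by
    intro i hi
    -- The null vectors `e i ± e (Fin.last m)`: the difference of the two relations isolates the
    -- mixed term, their sum the diagonal ones.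
    have h1 := hnull (e i + e (Fin.last m))
      (by simp [hll, hii i hi, hij i _ hi, hij _ i hi.symm])
    have h2 := hnull (e i - e (Fin.last m))
      (by simp [hll, hii i hi, hij i _ hi, hij _ i hi.symm])
    simp only [map_add, map_sub, LinearMap.add_apply, LinearMap.sub_apply,
      hβ (e (Fin.last m)) (e i)] at h1 h2
    constructor
    · have : (4 : ℝ) • β (e i) (e (Fin.last m)) = 0 := by
        rw [← sub_self (0 : W)]
        nth_rw 1 [← h1]
        rw [← h2]
        module
      simpa using this
    · have : (2 : ℝ) • (β (e i) (e i) + β (e (Fin.last m)) (e (Fin.last m))) = 0 := by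
        rw [← add_zero (0 : W)]
        nth_rw 1 [← h1]
        rw [← h2]
        module
      rw [smul_eq_zero] at this
      exact eq_neg_of_add_eq_zero_left (this.resolve_left (by norm_num))
  refine ⟨-β (e (Fin.last m)) (e (Fin.last m)), ?_⟩
  have hbasis : ∀ i j, β (e i) (e j) = B (e i) (e j) • -β (e (Fin.last m)) (e (Fin.last m)) := by
    intro i j
    by_cases h : i = j
    · subst h
      by_cases hi : i = Fin.last m
      · subst hi
        simp [hll]
      · rw [hii i hi, (key i hi).2, one_smul]
    · rw [hij i j h, zero_smul]
      by_cases hi : i = Fin.last m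
      · subst hi
        rw [hβ, (key j (Ne.symm h)).1]
      by_cases hj : j = Fin.last m
      · subst hj
        exact (key i hi).1
      -- Null since (3/5)² + (4/5)² = 1. By `key` the diagonal terms cancel and the terms with `e
      -- (Fin.last m)` vanish, leaving 2 · (3/5) · (4/5) = 24/25 times `β (e i) (e j)`.
      have h1 := hnull ((3 / 5 : ℝ) • e i + (4 / 5 : ℝ) • e j + e (Fin.last m)) (by
        simp [hll, hii i hi, hii j hj, hij i j h, hij j i (Ne.symm h), hij i _ hi,
          hij _ i (Ne.symm hi),
          hij j _ hj, hij _ j (Ne.symm hj)]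
        norm_num)
      simp only [map_add, map_smul, LinearMap.add_apply, LinearMap.smul_apply, hβ (e j) (e i),
        hβ (e (Fin.last m)) (e i), hβ (e (Fin.last m)) (e j), (key i hi).1, (key j hj).1,
        (key i hi).2, (key j hj).2] at h1
      have : (24 / 25 : ℝ) • β (e i) (e j) = 0 := by
        rw [← h1]
        module
      simpa using this
  intro u v
  have : β = B.compr₂ (LinearMap.toSpanSingleton ℝ W (-β (e (Fin.last m)) (e (Fin.last m)))) :=
    e.ext fun i ↦ e.ext fun j ↦ by simpa using hbasis i j
  conv_lhs => rw [this]
  simp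

end LorentzForm

/-! ### Uniqueness from Grönwall's inequality -/

section Gronwall

variable {E : Type*} [NormedAddCommGroup E] [NormedSpace ℝ E]

theorem eq_zero_of_norm_deriv_le {z : ℝ → E} {z' : ℝ → E} {K ε t₀ : ℝ} (h0 : z t₀ = 0)
    (hz : ∀ t ∈ Ioo (t₀ - ε) (t₀ + ε), HasDerivAt z (z' t) t)
    (hK : ∀ t ∈ Ioo (t₀ - ε) (t₀ + ε), ‖z' t‖ ≤ K * ‖z t‖) :
    ∀ t ∈ Ioo (t₀ - ε) (t₀ + ε), z t = 0 := by
  intro t ht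
  rcases le_total t₀ t with h | h
  · have hsub : Icc t₀ t ⊆ Ioo (t₀ - ε) (t₀ + ε) := fun s hs ↦
      ⟨by linarith [hs.1, hs.2, ht.1, ht.2], by linarith [hs.1, hs.2, ht.1, ht.2]⟩
    exact eq_zero_of_abs_deriv_le_mul_abs_self_of_eq_zero_right
      (fun s hs ↦ (hz s (hsub hs)).continuousAt.continuousWithinAt)
      (fun s hs ↦ (hz s (hsub (Ico_subset_Icc_self hs))).hasDerivWithinAt) h0
      (fun s hs ↦ hK s (hsub (Ico_subset_Icc_self hs))) t ⟨h, le_rfl⟩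
  -- Grönwall runs forward only, so times before `t₀` are handled by reversing time.
  · have hsub : ∀ s ∈ Icc (-t₀) (-t), -s ∈ Ioo (t₀ - ε) (t₀ + ε) := fun s hs ↦
      ⟨by linarith [hs.1, hs.2, ht.1, ht.2], by linarith [hs.1, hs.2, ht.1, ht.2]⟩
    have hd : ∀ s ∈ Icc (-t₀) (-t), HasDerivAt (fun s ↦ z (-s)) (-z' (-s)) s := fun s hs ↦ by
      simpa [Function.comp_def] using (hz (-s) (hsub s hs)).scomp s (hasDerivAt_neg s)
    have := eq_zero_of_abs_deriv_le_mul_abs_self_of_eq_zero_right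
      (f := fun s ↦ z (-s)) (f' := fun s ↦ -z' (-s)) (K := K) (a := -t₀) (b := -t)
      (fun s hs ↦ (hd s hs).continuousAt.continuousWithinAt)
      (fun s hs ↦ (hd s (Ico_subset_Icc_self hs)).hasDerivWithinAt) (by simpa using h0)
      (fun s hs ↦ by simpa using hK (-s) (hsub s (Ico_subset_Icc_self hs))) (-t)
      ⟨by linarith, le_rfl⟩
    simpa using this

theorem eq_zero_of_norm_second_deriv_le {z w a : ℝ → E} {K ε t₀ : ℝ}
    (hz0 : z t₀ = 0) (hw0 : w t₀ = 0)
    (hz : ∀ t ∈ Ioo (t₀ - ε) (t₀ + ε), HasDerivAt z (w t) t)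
    (hw : ∀ t ∈ Ioo (t₀ - ε) (t₀ + ε), HasDerivAt w (a t) t)
    (hK : ∀ t ∈ Ioo (t₀ - ε) (t₀ + ε), ‖a t‖ ≤ K * ‖(z t, w t)‖) :
    ∀ t ∈ Ioo (t₀ - ε) (t₀ + ε), z t = 0 := by
  -- First-order system for the pair `(z, w)`. The component `z' = w` needs constant 1, whence `max
  -- K 1`.
  have := eq_zero_of_norm_deriv_le (z := fun t ↦ (z t, w t)) (z' := fun t ↦ (w t, a t))
    (K := max K 1) (ε := ε) (t₀ := t₀) (by simp [hz0, hw0])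
    (fun t ht ↦ (hz t ht).prodMk (hw t ht)) (fun t ht ↦ by
      rw [Prod.norm_def]
      refine max_le ?_ ((hK t ht).trans (by gcongr; exact le_max_left _ _))
      calc ‖w t‖ ≤ ‖(z t, w t)‖ := norm_snd_le (z t, w t)
        _ = 1 * ‖(z t, w t)‖ := (one_mul _).symm
        _ ≤ _ := by gcongr; exact le_max_right _ _)
  exact fun t ht ↦ congrArg Prod.fst (this t ht)

end Gronwall

/-! ### Differentials of charts and coordinate changes -/

section Chart

variable {E : Type*} [NormedAddCommGroup E] [NormedSpace ℝ E]
  {M : Type*} [TopologicalSpace M] [ChartedSpace E M]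

/-- The differential of a chart, with values in the model space. -/
def chartDeriv (ψ : OpenPartialHomeomorph M E) (x : M) : E →L[ℝ] E :=
  mfderiv 𝓘(ℝ, E) 𝓘(ℝ, E) ψ x

/-- The differential of the inverse of a chart, defined on the model space. -/
def chartSymmDeriv (ψ : OpenPartialHomeomorph M E) (y : E) : E →L[ℝ] E :=
  mfderiv 𝓘(ℝ, E) 𝓘(ℝ, E) ψ.symm y

variable {ψ φ : OpenPartialHomeomorph M E}

theorem hasMFDerivAt_chart (hψ : ψ ∈ IsManifold.maximalAtlas 𝓘(ℝ, E) ∞ M) {x : M}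
    (hx : x ∈ ψ.source) : HasMFDerivAt 𝓘(ℝ, E) 𝓘(ℝ, E) ψ x (chartDeriv (E := E) ψ x :) :=
  ((contMDiffAt_of_mem_maximalAtlas hψ hx).mdifferentiableAt (by simp)).hasMFDerivAt

theorem hasMFDerivAt_chart_symm (hψ : ψ ∈ IsManifold.maximalAtlas 𝓘(ℝ, E) ∞ M) {y : E}
    (hy : y ∈ ψ.target) : HasMFDerivAt 𝓘(ℝ, E) 𝓘(ℝ, E) ψ.symm y (chartSymmDeriv (E := E) ψ y :) :=
  ((contMDiffAt_symm_of_mem_maximalAtlas hψ hy).mdifferentiableAt (by simp)).hasMFDerivAt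

theorem mdifferentiable_of_mem_maximalAtlas (hψ : ψ ∈ IsManifold.maximalAtlas 𝓘(ℝ, E) ∞ M) :
    ψ.MDifferentiable 𝓘(ℝ, E) 𝓘(ℝ, E) :=
  ⟨fun _ hx ↦ (hasMFDerivAt_chart hψ hx).mdifferentiableAt.mdifferentiableWithinAt,
    fun _ hy ↦ (hasMFDerivAt_chart_symm hψ hy).mdifferentiableAt.mdifferentiableWithinAt⟩

theorem chartSymmDeriv_chartDeriv (hψ : ψ ∈ IsManifold.maximalAtlas 𝓘(ℝ, E) ∞ M) {x : M}
    (hx : x ∈ ψ.source) (v : E) : chartSymmDeriv ψ (ψ x) (chartDeriv ψ x v) = v :=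
  DFunLike.congr_fun ((mdifferentiable_of_mem_maximalAtlas hψ).symm_comp_deriv hx) v

theorem chartDeriv_chartSymmDeriv (hψ : ψ ∈ IsManifold.maximalAtlas 𝓘(ℝ, E) ∞ M) {y : E}
    (hy : y ∈ ψ.target) (v : E) : chartDeriv ψ (ψ.symm y) (chartSymmDeriv ψ y v) = v :=
  DFunLike.congr_fun ((mdifferentiable_of_mem_maximalAtlas hψ).comp_symm_deriv hy) v

theorem chartDeriv_chartSymmDeriv' (hψ : ψ ∈ IsManifold.maximalAtlas 𝓘(ℝ, E) ∞ M) {x : M}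
    (hx : x ∈ ψ.source) (v : E) : chartDeriv ψ x (chartSymmDeriv ψ (ψ x) v) = v := by
  have := chartDeriv_chartSymmDeriv hψ (ψ.map_source hx) v
  rwa [ψ.left_inv hx] at this

theorem chartDeriv_injective (hψ : ψ ∈ IsManifold.maximalAtlas 𝓘(ℝ, E) ∞ M) {x : M}
    (hx : x ∈ ψ.source) : Function.Injective (chartDeriv ψ x) :=
  Function.LeftInverse.injective (chartSymmDeriv_chartDeriv hψ hx)

/-- The coordinate change between two charts of the maximal atlas is smooth. -/
theorem contDiffOn_chart_comp_symm (hφ : φ ∈ IsManifold.maximalAtlas 𝓘(ℝ, E) ∞ M)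
    (hψ : ψ ∈ IsManifold.maximalAtlas 𝓘(ℝ, E) ∞ M) :
    ContDiffOn ℝ ∞ (ψ ∘ φ.symm) (φ.symm ≫ₕ ψ).source := by
  rw [← contMDiffOn_iff_contDiffOn]
  refine (contMDiffOn_of_mem_maximalAtlas hψ).comp
    ((contMDiffOn_symm_of_mem_maximalAtlas hφ).mono fun y hy ↦ ?_) fun y hy ↦ ?_
  · exact (by simpa using hy : y ∈ φ.target ∧ _).1
  · exact (by simpa using hy : y ∈ φ.target ∧ φ.symm y ∈ ψ.source).2

theorem contDiffAt_chart_comp_symm (hφ : φ ∈ IsManifold.maximalAtlas 𝓘(ℝ, E) ∞ M)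
    (hψ : ψ ∈ IsManifold.maximalAtlas 𝓘(ℝ, E) ∞ M) {x : M} (hx : x ∈ φ.source)
    (hx' : x ∈ ψ.source) : ContDiffAt ℝ ∞ (ψ ∘ φ.symm) (φ x) :=
  (contDiffOn_chart_comp_symm hφ hψ).contDiffAt
    ((φ.symm ≫ₕ ψ).open_source.mem_nhds (by simp [hx, hx']))

theorem chartDeriv_eq_comp (hφ : φ ∈ IsManifold.maximalAtlas 𝓘(ℝ, E) ∞ M)
    (hψ : ψ ∈ IsManifold.maximalAtlas 𝓘(ℝ, E) ∞ M) {x : M} (hx : x ∈ φ.source)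
    (hx' : x ∈ ψ.source) (v : E) :
    chartDeriv ψ x v = fderiv ℝ (ψ ∘ φ.symm) (φ x) (chartDeriv φ x v) := by
  have h1 : HasMFDerivAt 𝓘(ℝ, E) 𝓘(ℝ, E) (ψ ∘ φ.symm) (φ x)
      ((chartDeriv ψ (φ.symm (φ x))).comp (chartSymmDeriv φ (φ x)) :) :=
    HasMFDerivAt.comp (φ x)
      (hasMFDerivAt_chart hψ (by rwa [φ.left_inv hx] : φ.symm (φ x) ∈ ψ.source))
      (hasMFDerivAt_chart_symm hφ (φ.map_source hx))
  have h2 : HasFDerivAt (ψ ∘ φ.symm)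
      ((chartDeriv ψ (φ.symm (φ x))).comp (chartSymmDeriv φ (φ x))) (φ x) := h1.hasFDerivAt
  rw [h2.fderiv, ContinuousLinearMap.comp_apply, chartSymmDeriv_chartDeriv hφ hx, φ.left_inv hx]

theorem chartSymmDeriv_eq_comp (hφ : φ ∈ IsManifold.maximalAtlas 𝓘(ℝ, E) ∞ M)
    (hψ : ψ ∈ IsManifold.maximalAtlas 𝓘(ℝ, E) ∞ M) {y : E} (hy : y ∈ φ.target)
    (hy' : φ.symm y ∈ ψ.source) (v : E) :
    chartSymmDeriv φ y v =
      chartSymmDeriv ψ (ψ (φ.symm y)) (fderiv ℝ (ψ ∘ φ.symm) y v) := by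
  apply chartDeriv_injective hψ hy'
  have := chartDeriv_eq_comp hφ hψ (φ.map_target hy) hy' (chartSymmDeriv φ y v)
  rw [this, φ.right_inv hy, chartDeriv_chartSymmDeriv hφ hy, chartDeriv_chartSymmDeriv' hψ hy']

variable [IsManifold 𝓘(ℝ, E) ∞ M]

theorem chartDeriv_chartAt_self (x : M) :
    chartDeriv (chartAt E x) x = ContinuousLinearMap.id ℝ E := by
  have := mfderiv_extChartAt_self (I := 𝓘(ℝ, E)) (x := x)
  simpa [chartDeriv] using! this

theorem chartSymmDeriv_chartAt_self (x : M) :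
    chartSymmDeriv (chartAt E x) (chartAt E x x) = ContinuousLinearMap.id ℝ E := by
  ext v
  have := chartSymmDeriv_chartDeriv (IsManifold.chart_mem_maximalAtlas x)
    (mem_chart_source E x) v
  rwa [chartDeriv_chartAt_self] at this

end Chart

/-! ### The metric and Christoffel symbols in an arbitrary chart -/

section Metric

variable {E : Type*} [NormedAddCommGroup E] [NormedSpace ℝ E]
  {M : Type*} [TopologicalSpace M] [ChartedSpace E M] [IsManifold 𝓘(ℝ, E) ∞ M]
  (g : SemiRiemannianMetric E M) {ψ φ : OpenPartialHomeomorph M E}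

/-- The metric at a point as a continuous bilinear form on the model space. -/
def SemiRiemannianMetric.modelVal (x : M) : E →L[ℝ] E →L[ℝ] ℝ :=
  g.val x

/-- The coordinate expression of the metric in an arbitrary chart. -/
def SemiRiemannianMetric.metricIn (ψ : OpenPartialHomeomorph M E) (y : E) :
    E →L[ℝ] E →L[ℝ] ℝ :=
  (g.modelVal (ψ.symm y)).bilinearComp (chartSymmDeriv ψ y) (chartSymmDeriv ψ y)

theorem SemiRiemannianMetric.metricIn_apply (y u v : E) :
    g.metricIn ψ y u v = g.modelVal (ψ.symm y) (chartSymmDeriv ψ y u) (chartSymmDeriv ψ y v) := by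
  simp [metricIn]

theorem SemiRiemannianMetric.metricIn_symm (y u v : E) :
    g.metricIn ψ y u v = g.metricIn ψ y v u := by
  simp only [metricIn_apply]
  exact g.symm _ _ _

theorem SemiRiemannianMetric.metricIn_chartDeriv
    (hψ : ψ ∈ IsManifold.maximalAtlas 𝓘(ℝ, E) ∞ M) {x : M} (hx : x ∈ ψ.source) (u v : E) :
    g.metricIn ψ (ψ x) (chartDeriv ψ x u) (chartDeriv ψ x v) = g.modelVal x u v := by
  rw [metricIn_apply, chartSymmDeriv_chartDeriv hψ hx, chartSymmDeriv_chartDeriv hψ hx,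
    ψ.left_inv hx]

theorem SemiRiemannianMetric.isInvertible_metricIn [FiniteDimensional ℝ E]
    (hψ : ψ ∈ IsManifold.maximalAtlas 𝓘(ℝ, E) ∞ M) {y : E} (hy : y ∈ ψ.target) :
    (g.metricIn ψ y).IsInvertible := by
  refine isInvertible_of_nondegenerate fun v hv ↦ ?_
  have h : chartSymmDeriv ψ y v = 0 := g.nondegenerate (ψ.symm y) (chartSymmDeriv ψ y v) fun w ↦ by
    have := hv (chartDeriv ψ (ψ.symm y) w)
    rw [metricIn_apply] at this
    have h2 := chartSymmDeriv_chartDeriv hψ (ψ.map_target hy) w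
    rw [ψ.right_inv hy] at h2
    rwa [h2] at this
  rw [← chartDeriv_chartSymmDeriv hψ hy v, h, map_zero]

/-- Coordinate vector fields are images of constant fields under the tangent map of the inverse
chart. -/
theorem contMDiffOn_chartSymmDeriv_section (hψ : ψ ∈ IsManifold.maximalAtlas 𝓘(ℝ, E) ∞ M) (u : E) :
    ContMDiffOn 𝓘(ℝ, E) 𝓘(ℝ, E).tangent ∞
      (fun y ↦ (⟨ψ.symm y, chartSymmDeriv ψ y u⟩ : TangentBundle 𝓘(ℝ, E) M)) ψ.target := by
  have h1 := (contMDiffOn_symm_of_mem_maximalAtlas hψ).contMDiffOn_tangentMapWithin (m := ∞)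
    (by simp) ψ.open_target.uniqueMDiffOn
  have h2 : ContMDiff 𝓘(ℝ, E) 𝓘(ℝ, E).tangent ∞
      (fun y ↦ (⟨y, u⟩ : TangentBundle 𝓘(ℝ, E) E)) := by
    rw [contMDiff_vectorSpace_iff_contDiff (V := fun _ ↦ u)]
    exact contDiff_const
  refine (h1.comp h2.contMDiffOn (fun y hy ↦ hy)).congr fun y hy ↦ ?_
  simp only [Function.comp_apply, tangentMapWithin]
  congr 1
  rw [mfderivWithin_of_mem_nhds (ψ.open_target.mem_nhds hy)]
  rfl

theorem SemiRiemannianMetric.contDiffOn_metricIn [FiniteDimensional ℝ E]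
    (hψ : ψ ∈ IsManifold.maximalAtlas 𝓘(ℝ, E) ∞ M) :
    ContDiffOn ℝ ∞ (g.metricIn ψ) ψ.target := by
  rw [contDiffOn_clm_apply]
  intro u
  rw [contDiffOn_clm_apply]
  intro v
  simp only [metricIn_apply]
  have : ContMDiffOn 𝓘(ℝ, E) (𝓘(ℝ, E).prod 𝓘(ℝ)) ∞
      (fun y ↦ Bundle.TotalSpace.mk' ℝ (E := Bundle.Trivial M ℝ) (ψ.symm y)
        (g.val (ψ.symm y) (chartSymmDeriv ψ y u) (chartSymmDeriv ψ y v))) ψ.target := by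
    apply ContMDiffOn.clm_bundle_apply₂ (F₁ := E) (F₂ := E)
    · exact g.contMDiff.comp_contMDiffOn (contMDiffOn_symm_of_mem_maximalAtlas hψ)
    · exact contMDiffOn_chartSymmDeriv_section hψ u
    · exact contMDiffOn_chartSymmDeriv_section hψ v
  rw [← contMDiffOn_iff_contDiffOn]
  intro y hy
  have h := this y hy
  rw [Bundle.contMDiffWithinAt_totalSpace] at h
  exact h.2

theorem SemiRiemannianMetric.inChart_eq (x : M) : g.inChart x = g.metricIn (chartAt E x) := by
  ext y u v
  simp [inChart, metricIn]
  rfl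

theorem SemiRiemannianMetric.metricIn_chartAt_self (x : M) :
    g.metricIn (chartAt E x) (chartAt E x x) = g.modelVal x := by
  ext u v
  rw [metricIn_apply, chartSymmDeriv_chartAt_self, (chartAt E x).left_inv (mem_chart_source E x)]
  rfl

/-- The preferred chart at `x` has identity differential at `x`, so the form used to raise the index
in `christoffel` is the coordinate metric there. -/
theorem SemiRiemannianMetric.christoffel_eq [FiniteDimensional ℝ E] (x : M) (u v : E) :
    g.christoffel x u v = christ (g.metricIn (chartAt E x)) (chartAt E x x) u v := by
  have hinv := g.isInvertible_metricIn (IsManifold.chart_mem_maximalAtlas x)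
    (mem_chart_target E x)
  apply hinv.injective
  ext w
  rw [apply_christ hinv, koszul_apply, metricIn_chartAt_self]
  have h : g.modelForm x (g.christoffel x u v) w = g.christoffelLower x u v w :=
    LinearMap.BilinForm.apply_toDual_symm_apply _ _
  refine h.trans ?_
  simp [christoffelLower, inChart_eq]

/-- The Christoffel symbols in two charts are related by the usual transformation law. -/
theorem SemiRiemannianMetric.fderiv_christ_metricIn [FiniteDimensional ℝ E]
    (hφ : φ ∈ IsManifold.maximalAtlas 𝓘(ℝ, E) ∞ M)
    (hψ : ψ ∈ IsManifold.maximalAtlas 𝓘(ℝ, E) ∞ M) {x : M} (hx : x ∈ φ.source)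
    (hx' : x ∈ ψ.source) (u v : E) :
    fderiv ℝ (ψ ∘ φ.symm) (φ x) (christ (g.metricIn φ) (φ x) u v) =
      christ (g.metricIn ψ) (ψ x) (fderiv ℝ (ψ ∘ φ.symm) (φ x) u)
        (fderiv ℝ (ψ ∘ φ.symm) (φ x) v) + fderiv ℝ (fderiv ℝ (ψ ∘ φ.symm)) (φ x) u v := by
  have hτx : (ψ ∘ φ.symm) (φ x) = ψ x := by simp [hx]
  have := fderiv_christ_pullback (G := g.metricIn ψ) (G' := g.metricIn φ) (τ := ψ ∘ φ.symm)
    (y := φ x) ((contDiffAt_chart_comp_symm hφ hψ hx hx').of_le (WithTop.coe_le_coe.2 le_top))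
    (fun w ↦ ⟨chartDeriv φ x (chartSymmDeriv ψ (ψ x) w), by
      rw [← chartDeriv_eq_comp hφ hψ hx hx', chartDeriv_chartSymmDeriv' hψ hx']⟩)
    (by
      rw [hτx]
      exact ((g.contDiffOn_metricIn hψ).contDiffAt
        (ψ.open_target.mem_nhds (ψ.map_source hx'))).differentiableAt (by simp))
    (fun v w ↦ g.metricIn_symm _ _ _)
    (by rw [hτx]; exact g.isInvertible_metricIn hψ (ψ.map_source hx'))
    (g.isInvertible_metricIn hφ (φ.map_source hx))
    (by
      filter_upwards [(φ.symm ≫ₕ ψ).open_source.mem_nhds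
        (show φ x ∈ (φ.symm ≫ₕ ψ).source by simp [hx, hx'])] with z hz
      have hz' : z ∈ φ.target ∧ φ.symm z ∈ ψ.source := by simpa using hz
      ext a b
      simp only [ContinuousLinearMap.bilinearComp_apply, metricIn_apply, Function.comp_apply]
      rw [ψ.left_inv hz'.2, chartSymmDeriv_eq_comp hφ hψ hz'.1 hz'.2,
        chartSymmDeriv_eq_comp hφ hψ hz'.1 hz'.2]) u v
  rwa [hτx] at this

end Metric

/-! ### Chart independence of the covariant derivative along a map -/

section CovDeriv

variable {E : Type*} [NormedAddCommGroup E] [NormedSpace ℝ E]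
  {M : Type*} [TopologicalSpace M] [ChartedSpace E M] [IsManifold 𝓘(ℝ, E) ∞ M]
  {E' : Type*} [NormedAddCommGroup E'] [NormedSpace ℝ E']
  {N : Type*} [TopologicalSpace N] [ChartedSpace E' N]
  (g : SemiRiemannianMetric E M) {ψ : OpenPartialHomeomorph M E}

/-- The differential of a map between manifolds, as a map between the model spaces. -/
def modelDeriv {E M : Type*} [NormedAddCommGroup E] [NormedSpace ℝ E] [TopologicalSpace M]
    [ChartedSpace E M] (f : N → M) (p : N) : E' →L[ℝ] E :=
  mfderiv 𝓘(ℝ, E') 𝓘(ℝ, E) f p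

/-- Product rule for `Dτ(h) Z`, the form in which the components of a field along a map change when
`τ` is a coordinate change. -/
theorem hasMFDerivAt_fderiv_apply {τ : E → E} {h Z : N → E} {p : N} {h' Z' : E' →L[ℝ] E}
    (hτ : DifferentiableAt ℝ (fderiv ℝ τ) (h p))
    (hh : HasMFDerivAt 𝓘(ℝ, E') 𝓘(ℝ, E) h p h') (hZ : HasMFDerivAt 𝓘(ℝ, E') 𝓘(ℝ, E) Z p Z') :
    HasMFDerivAt 𝓘(ℝ, E') 𝓘(ℝ, E) (fun q ↦ fderiv ℝ τ (h q) (Z q)) p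
      ((fderiv ℝ τ (h p)).comp Z' + ((fderiv ℝ (fderiv ℝ τ) (h p)).flip (Z p)).comp h' :) := by
  refine ⟨(hτ.continuousAt.comp hh.1).clm_apply hZ.1, ?_⟩
  set e := extChartAt 𝓘(ℝ, E') p
  have hp : e.symm (e p) = p := extChartAt_to_inv p
  have h1 : HasFDerivWithinAt (fun y ↦ h (e.symm y)) h' (range 𝓘(ℝ, E')) (e p) := hh.2
  have h2 : HasFDerivWithinAt (fun y ↦ Z (e.symm y)) Z' (range 𝓘(ℝ, E')) (e p) := hZ.2
  have h3 : HasFDerivWithinAt (fun y ↦ fderiv ℝ τ (h (e.symm y)))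
      ((fderiv ℝ (fderiv ℝ τ) (h p)).comp h') (range 𝓘(ℝ, E')) (e p) := by
    refine HasFDerivAt.comp_hasFDerivWithinAt (e p) (f := fun y ↦ h (e.symm y)) ?_ h1
    simp only [hp]
    exact hτ.hasFDerivAt
  have h4 := h3.clm_apply h2
  simp only [hp] at h4
  exact h4

variable [FiniteDimensional ℝ E]

/-- The covariant derivative along a map, expressed in an arbitrary chart. -/
theorem SemiRiemannianMetric.chartDeriv_covDerivAlong
    (hψ : ψ ∈ IsManifold.maximalAtlas 𝓘(ℝ, E) ∞ M) {f : N → M}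
    {Y : ∀ p : N, TangentSpace 𝓘(ℝ, E) (f p)} {p : N} (hfp : f p ∈ ψ.source)
    (hf : MDifferentiableAt 𝓘(ℝ, E') 𝓘(ℝ, E) f p) {Y' : E' →L[ℝ] E}
    (hY : HasMFDerivAt 𝓘(ℝ, E') 𝓘(ℝ, E) (fun q ↦ (chartDeriv ψ (f q) (Y q) : E)) p Y') (v : E') :
    chartDeriv ψ (f p) (g.covDerivAlong f Y p v) = Y' v +
      christ (g.metricIn ψ) (ψ (f p)) (chartDeriv ψ (f p) (mfderiv 𝓘(ℝ, E') 𝓘(ℝ, E) f p v))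
        (chartDeriv ψ (f p) (Y p)) := by
  set φ := chartAt E (f p)
  have hφ : φ ∈ IsManifold.maximalAtlas 𝓘(ℝ, E) ∞ M := IsManifold.chart_mem_maximalAtlas (f p)
  have hfφ : f p ∈ φ.source := mem_chart_source E (f p)
  have hφid : chartDeriv φ (f p) = ContinuousLinearMap.id ℝ E := chartDeriv_chartAt_self (f p)
  have hcomp : ∀ {χ : OpenPartialHomeomorph M E}, χ ∈ IsManifold.maximalAtlas 𝓘(ℝ, E) ∞ M →
      f p ∈ χ.source → HasMFDerivAt 𝓘(ℝ, E') 𝓘(ℝ, E) (fun q ↦ χ (f q)) p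
        ((chartDeriv χ (f p)).comp (mfderiv 𝓘(ℝ, E') 𝓘(ℝ, E) f p : E' →L[ℝ] E) :) :=
    fun hχ hx ↦ HasMFDerivAt.comp p (hasMFDerivAt_chart hχ hx) hf.hasMFDerivAt
  have hdiff : ∀ {χ χ' : OpenPartialHomeomorph M E}, χ ∈ IsManifold.maximalAtlas 𝓘(ℝ, E) ∞ M →
      χ' ∈ IsManifold.maximalAtlas 𝓘(ℝ, E) ∞ M → f p ∈ χ.source → f p ∈ χ'.source →
      DifferentiableAt ℝ (fderiv ℝ (χ' ∘ χ.symm)) (χ (f p)) := fun hχ hχ' hx hx' ↦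
    ((contDiffAt_chart_comp_symm hχ hχ' hx hx').fderiv_right (m := 1)
      (WithTop.coe_le_coe.2 le_top)).differentiableAt (by norm_num)
  have hev : ∀ᶠ q in 𝓝 p, f q ∈ φ.source ∧ f q ∈ ψ.source :=
    (hf.continuousAt.eventually (φ.open_source.mem_nhds hfφ)).and
      (hf.continuousAt.eventually (ψ.open_source.mem_nhds hfp))
  -- Differentiability is assumed for the components in `ψ`, but the definition uses the preferred
  -- chart `φ`; the coordinate change transfers it.
  obtain ⟨D, hD⟩ : ∃ D : E' →L[ℝ] E,
      HasMFDerivAt 𝓘(ℝ, E') 𝓘(ℝ, E) (fun q ↦ (chartDeriv φ (f q) (Y q) : E)) p D :=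
    ⟨_, (hasMFDerivAt_fderiv_apply (h := fun q ↦ ψ (f q)) (hdiff hψ hφ hfp hfφ) (hcomp hψ hfp) hY).congr_of_eventuallyEq
      (hev.mono fun q hq ↦ chartDeriv_eq_comp hψ hφ hq.2 hq.1 (Y q))⟩
  have hY2 := (hasMFDerivAt_fderiv_apply (h := fun q ↦ φ (f q)) (hdiff hφ hψ hfφ hfp) (hcomp hφ hfφ)
    hD).congr_of_eventuallyEq (hev.mono fun q hq ↦ chartDeriv_eq_comp hφ hψ hq.1 hq.2 (Y q))
  have hY' : Y' = _ := hasMFDerivAt_unique hY hY2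
  have hcov : g.covDerivAlong f Y p v =
      (D v + christ (g.metricIn φ) (φ (f p)) (modelDeriv f p v) (Y p) : E) := by
    have hD' : modelDeriv (fun q ↦ (chartDeriv φ (f q) (Y q) : E)) p = D := hD.mfderiv
    exact congrArg₂ (fun a b : E ↦ a + b) (DFunLike.congr_fun hD' v)
      (g.christoffel_eq (f p) (modelDeriv f p v) (Y p))
  rw [hcov, hY']
  have main : ∀ (u y : E), chartDeriv ψ (f p) (D v + christ (g.metricIn φ) (φ (f p)) u y) =
      fderiv ℝ (ψ ∘ φ.symm) (φ (f p)) (D v) + fderiv ℝ (fderiv ℝ (ψ ∘ φ.symm)) (φ (f p))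
        (chartDeriv φ (f p) u) (chartDeriv φ (f p) y) +
      christ (g.metricIn ψ) (ψ (f p)) (chartDeriv ψ (f p) u) (chartDeriv ψ (f p) y) := by
    intro u y
    simp only [chartDeriv_eq_comp hφ hψ hfφ hfp, hφid, ContinuousLinearMap.id_apply, map_add]
    -- The inhomogeneous term of the Christoffel symbols is exactly the second-derivative term that
    -- the product rule put into `hY2`.
    rw [g.fderiv_christ_metricIn hφ hψ hfφ hfp]
    abel
  exact main (modelDeriv f p v) (Y p)

end CovDeriv

/-! ### The geodesic equation in a chart -/

section Geodesic

variable {E : Type*} [NormedAddCommGroup E] [NormedSpace ℝ E]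
  {M : Type*} [TopologicalSpace M] [ChartedSpace E M]
  {ψ : OpenPartialHomeomorph M E} {γ : ℝ → M} {a b t : ℝ}

theorem hasDerivAt_chart_comp (hψ : ψ ∈ IsManifold.maximalAtlas 𝓘(ℝ, E) ∞ M)
    (hγ : MDifferentiableAt 𝓘(ℝ, ℝ) 𝓘(ℝ, E) γ t) (ht : γ t ∈ ψ.source) :
    HasDerivAt (fun s ↦ ψ (γ s)) (chartDeriv ψ (γ t) (velocity γ t)) t := by
  have h : HasMFDerivAt 𝓘(ℝ, ℝ) 𝓘(ℝ, E) (fun s ↦ ψ (γ s)) t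
      ((chartDeriv ψ (γ t)).comp (mfderiv 𝓘(ℝ, ℝ) 𝓘(ℝ, E) γ t : ℝ →L[ℝ] E) :) :=
    HasMFDerivAt.comp t (hasMFDerivAt_chart hψ ht) hγ.hasMFDerivAt
  have h2 : HasFDerivAt (fun s ↦ ψ (γ s))
      ((chartDeriv ψ (γ t)).comp (mfderiv 𝓘(ℝ, ℝ) 𝓘(ℝ, E) γ t : ℝ →L[ℝ] E)) t := h.hasFDerivAt
  exact h2.hasDerivAt

variable [IsManifold 𝓘(ℝ, E) ∞ M] [FiniteDimensional ℝ E] {g : SemiRiemannianMetric E M}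

theorem SemiRiemannianMetric.IsGeodesicOn.mdifferentiableAt (hγ : g.IsGeodesicOn γ a b)
    (ht : t ∈ Ioo a b) : MDifferentiableAt 𝓘(ℝ, ℝ) 𝓘(ℝ, E) γ t :=
  (hγ.1.contMDiffAt (Ioo_mem_nhds ht.1 ht.2)).mdifferentiableAt (by norm_num)

theorem SemiRiemannianMetric.chartDeriv_covDerivAlong_velocity
    (hψ : ψ ∈ IsManifold.maximalAtlas 𝓘(ℝ, E) ∞ M)
    (hγ : MDifferentiableAt 𝓘(ℝ, ℝ) 𝓘(ℝ, E) γ t) (ht : γ t ∈ ψ.source) {w' : E}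
    (hw : HasDerivAt (fun s ↦ chartDeriv ψ (γ s) (velocity γ s)) w' t) :
    chartDeriv ψ (γ t) (g.covDerivAlong γ (velocity (E := E) γ) t (1 : ℝ)) =
      w' + christ (g.metricIn ψ) (ψ (γ t)) (chartDeriv ψ (γ t) (velocity γ t))
        (chartDeriv ψ (γ t) (velocity γ t)) := by
  have := g.chartDeriv_covDerivAlong hψ ht hγ (Y := velocity (E := E) γ)
    (Y' := ContinuousLinearMap.toSpanSingleton ℝ w') hw.hasFDerivAt.hasMFDerivAt 1
  rw [ContinuousLinearMap.toSpanSingleton_apply, one_smul] at this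
  exact this

/-- The geodesic equation in an arbitrary chart. -/
theorem SemiRiemannianMetric.IsGeodesicOn.hasDerivAt_chart
    (hψ : ψ ∈ IsManifold.maximalAtlas 𝓘(ℝ, E) ∞ M) (hγ : g.IsGeodesicOn γ a b)
    (ht : t ∈ Ioo a b) (hs : γ t ∈ ψ.source) :
    HasDerivAt (fun s ↦ chartDeriv ψ (γ s) (velocity γ s))
      (-christ (g.metricIn ψ) (ψ (γ t)) (chartDeriv ψ (γ t) (velocity γ t))
        (chartDeriv ψ (γ t) (velocity γ t))) t := by
  have hmd := hγ.mdifferentiableAt ht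
  have hC : ContDiffAt ℝ 2 (fun s ↦ ψ (γ s)) t := by
    rw [← contMDiffAt_iff_contDiffAt]
    exact ((contMDiffAt_of_mem_maximalAtlas hψ hs).of_le (WithTop.coe_le_coe.2 le_top)).comp t
      (hγ.1.contMDiffAt (Ioo_mem_nhds ht.1 ht.2))
  have hev : (fun s ↦ chartDeriv ψ (γ s) (velocity γ s)) =ᶠ[𝓝 t] deriv fun s ↦ ψ (γ s) := by
    filter_upwards [Ioo_mem_nhds ht.1 ht.2,
      hmd.continuousAt.eventually (ψ.open_source.mem_nhds hs)] with s hs1 hs2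
    exact (hasDerivAt_chart_comp hψ (hγ.mdifferentiableAt hs1) hs2).deriv.symm
  have hd : DifferentiableAt ℝ (deriv fun s ↦ ψ (γ s)) t := by
    have : DifferentiableAt ℝ (fderiv ℝ fun s ↦ ψ (γ s)) t :=
      (hC.fderiv_right (m := 1) (by norm_num)).differentiableAt (by norm_num)
    exact this.clm_apply (differentiableAt_const 1)
  have hw := (hd.congr_of_eventuallyEq hev).hasDerivAt
  have h := g.chartDeriv_covDerivAlong_velocity hψ hmd hs hw
  have h0 : chartDeriv ψ (γ t) (g.covDerivAlong γ (velocity (E := E) γ) t (1 : ℝ)) = 0 := by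
    rw [hγ.2 t ht]
    exact map_zero _
  rw [h0] at h
  rwa [eq_neg_of_add_eq_zero_left h.symm] at hw

/-- Solutions of the geodesic equation in a chart define geodesics. -/
theorem SemiRiemannianMetric.isGeodesicOn_of_hasDerivAt
    (hψ : ψ ∈ IsManifold.maximalAtlas 𝓘(ℝ, E) ∞ M) {x w : ℝ → E}
    (hx : ∀ t ∈ Ioo a b, x t ∈ ψ.target) (hxw : ∀ t ∈ Ioo a b, HasDerivAt x (w t) t)
    (hw : ∀ t ∈ Ioo a b, HasDerivAt w (-christ (g.metricIn ψ) (x t) (w t) (w t)) t) :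
    g.IsGeodesicOn (fun t ↦ ψ.symm (x t)) a b ∧
      ∀ t ∈ Ioo a b,
        chartDeriv ψ (ψ.symm (x t)) (velocity (E := E) (fun t ↦ ψ.symm (x t)) t) = w t := by
  -- Bootstrapping to the C² regularity demanded of geodesics: the equation makes the derivative of
  -- `w` continuous, so `w` is C¹ and `x` is C².
  have hC1 : ContDiffOn ℝ 1 w (Ioo a b) := by
    have h01 : (1 : WithTop ℕ∞) = 0 + 1 := by norm_num
    rw [h01, contDiffOn_succ_iff_deriv_of_isOpen isOpen_Ioo]
    refine ⟨fun t ht ↦ (hw t ht).differentiableAt.differentiableWithinAt, by simp, ?_⟩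
    rw [contDiffOn_zero]
    refine ContinuousOn.congr (f := fun t ↦ -christ (g.metricIn ψ) (x t) (w t) (w t)) ?_
      fun t ht ↦ (hw t ht).deriv
    have hcx : ContinuousOn x (Ioo a b) := fun t ht ↦ (hxw t ht).continuousAt.continuousWithinAt
    have hcw : ContinuousOn w (Ioo a b) := fun t ht ↦ (hw t ht).continuousAt.continuousWithinAt
    have hc := (contDiffOn_christ ψ.open_target (g.contDiffOn_metricIn hψ)
      fun y hy ↦ g.isInvertible_metricIn hψ hy).continuousOn
    exact (((hc.comp hcx hx).clm_apply hcw).clm_apply hcw).neg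
  have hC2 : ContDiffOn ℝ 2 x (Ioo a b) := by
    have h12 : (2 : WithTop ℕ∞) = 1 + 1 := by norm_num
    rw [h12, contDiffOn_succ_iff_deriv_of_isOpen isOpen_Ioo]
    exact ⟨fun t ht ↦ (hxw t ht).differentiableAt.differentiableWithinAt, by simp,
      hC1.congr fun t ht ↦ (hxw t ht).deriv⟩
  have hγC : ContMDiffOn 𝓘(ℝ, ℝ) 𝓘(ℝ, E) 2 (fun t ↦ ψ.symm (x t)) (Ioo a b) :=
    ((contMDiffOn_symm_of_mem_maximalAtlas hψ).of_le (WithTop.coe_le_coe.2 le_top)).comp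
      hC2.contMDiffOn hx
  have hmd : ∀ t ∈ Ioo a b, MDifferentiableAt 𝓘(ℝ, ℝ) 𝓘(ℝ, E) (fun t ↦ ψ.symm (x t)) t :=
    fun t ht ↦ (hγC.contMDiffAt (Ioo_mem_nhds ht.1 ht.2)).mdifferentiableAt (by norm_num)
  have hvel : ∀ t ∈ Ioo a b,
      chartDeriv ψ (ψ.symm (x t)) (velocity (E := E) (fun t ↦ ψ.symm (x t)) t) = w t := by
    intro t ht
    refine (hasDerivAt_chart_comp hψ (hmd t ht) (ψ.map_target (hx t ht))).unique ?_
    refine (hxw t ht).congr_of_eventuallyEq ?_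
    filter_upwards [Ioo_mem_nhds ht.1 ht.2] with s hs
    exact ψ.right_inv (hx s hs)
  refine ⟨⟨hγC, fun t ht ↦ ?_⟩, hvel⟩
  have hw' : HasDerivAt
      (fun s ↦ chartDeriv ψ (ψ.symm (x s)) (velocity (E := E) (fun t ↦ ψ.symm (x t)) s))
      (-christ (g.metricIn ψ) (x t) (w t) (w t)) t := by
    refine (hw t ht).congr_of_eventuallyEq ?_
    filter_upwards [Ioo_mem_nhds ht.1 ht.2] with s hs
    exact hvel s hs
  apply chartDeriv_injective hψ (ψ.map_target (hx t ht))
  have h := g.chartDeriv_covDerivAlong_velocity hψ (hmd t ht) (ψ.map_target (hx t ht)) hw'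
  refine h.trans ?_
  rw [hvel t ht, ψ.right_inv (hx t ht), neg_add_cancel]
  exact (map_zero _).symm

end Geodesic

/-! ### Orthogonal projection off a nondegenerate subspace -/

section NormalPart

variable {E E' : Type*} [NormedAddCommGroup E] [NormedSpace ℝ E] [NormedAddCommGroup E']
  [NormedSpace ℝ E']

/-- The component of `w` orthogonal to the range of `ι` with respect to the bilinear form `B`. -/
def normalPart (ι : E' →L[ℝ] E) (B : E →L[ℝ] E →L[ℝ] ℝ) (w : E) : E :=
  w - ι ((B.bilinearComp ι ι).inverse ((B w).comp ι))

variable {ι : E' →L[ℝ] E} {B : E →L[ℝ] E →L[ℝ] ℝ}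

theorem apply_normalPart (hB : (B.bilinearComp ι ι).IsInvertible) (w : E) (v : E') :
    B (normalPart ι B w) (ι v) = 0 := by
  have h : B.bilinearComp ι ι ((B.bilinearComp ι ι).inverse ((B w).comp ι)) = (B w).comp ι :=
    hB.self_apply_inverse _
  have h2 := DFunLike.congr_fun h v
  simp only [ContinuousLinearMap.bilinearComp_apply, ContinuousLinearMap.comp_apply] at h2
  simp [normalPart, h2]

/-- The orthogonal representative of a class modulo the range of `ι` is unique, as the restricted
form is nondegenerate. This identifies a pointwise chosen normal vector with an explicit smooth
expression. -/
theorem eq_normalPart (hB : (B.bilinearComp ι ι).IsInvertible) {w w' : E} {η : E'}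
    (h : w' - w = ι η) (hw' : ∀ v, B w' (ι v) = 0) : w' = normalPart ι B w := by
  have h1 : (B.bilinearComp ι ι).inverse ((B w).comp ι) = -η := by
    rw [hB.inverse_apply_eq]
    ext v
    have h2 := hw' v
    rw [← sub_add_cancel w' w, h] at h2
    simp only [map_add, add_apply] at h2
    simp only [map_neg, neg_apply, ContinuousLinearMap.bilinearComp_apply,
      ContinuousLinearMap.comp_apply]
    linarith
  rw [normalPart, h1, map_neg, ← h]
  abel

theorem contDiffAt_normalPart [FiniteDimensional ℝ E'] {F : Type*} [NormedAddCommGroup F]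
    [NormedSpace ℝ F] {G : F → E →L[ℝ] E →L[ℝ] ℝ} {W : F → E} {u : F} {n : WithTop ℕ∞}
    (hG : ContDiffAt ℝ n G u) (hW : ContDiffAt ℝ n W u)
    (hB : ((G u).bilinearComp ι ι).IsInvertible) :
    ContDiffAt ℝ n (fun y ↦ normalPart ι (G y) (W y)) u := by
  have : CompleteSpace E' := FiniteDimensional.complete ℝ E'
  have hGc : ContDiffAt ℝ n (fun y ↦ (G y).bilinearComp ι ι) u := by
    have : (fun y ↦ (G y).bilinearComp ι ι) =
        fun y ↦ (ContinuousLinearMap.precomp ℝ ι) ∘L (G y) ∘L ι := by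
      ext y v w
      simp
    rw [this]
    exact contDiffAt_const.clm_comp (hG.clm_comp contDiffAt_const)
  have hinv := (hB.contDiffAt_map_inverse (n := n)).comp u hGc
  exact hW.sub (contDiffAt_const.clm_apply
    (hinv.clm_apply ((hG.clm_apply hW).clm_comp contDiffAt_const)))

end NormalPart

/-! ### Smoothness of vector fields through chart components -/

section Bundle

variable {E : Type*} [NormedAddCommGroup E] [NormedSpace ℝ E]
  {M : Type*} [TopologicalSpace M] [ChartedSpace E M]
  {ψ : OpenPartialHomeomorph M E}

/-- Comparing components in one fixed chart avoids transporting vectors between fibres whose base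
points are equal only propositionally. -/
theorem tangentBundle_ext (hψ : ψ ∈ IsManifold.maximalAtlas 𝓘(ℝ, E) ∞ M)
    {P Q : TangentBundle 𝓘(ℝ, E) M} (h : P.1 = Q.1) (hP : P.1 ∈ ψ.source)
    (hd : chartDeriv ψ P.1 P.2 = chartDeriv ψ Q.1 Q.2) : P = Q := by
  obtain ⟨x, v⟩ := P
  obtain ⟨y, w⟩ := Q
  obtain rfl : x = y := h
  exact congrArg (Bundle.TotalSpace.mk x) (chartDeriv_injective hψ hP hd)

variable [IsManifold 𝓘(ℝ, E) ∞ M]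

/-- A smooth section has smooth components in any chart. -/
theorem contMDiffOn_chartDeriv (hψ : ψ ∈ IsManifold.maximalAtlas 𝓘(ℝ, E) ∞ M) {U : Set M}
    {Y : ∀ p : M, TangentSpace 𝓘(ℝ, E) p}
    (hY : ContMDiffOn 𝓘(ℝ, E) 𝓘(ℝ, E).tangent ∞
      (fun p ↦ (⟨p, Y p⟩ : TangentBundle 𝓘(ℝ, E) M)) U) :
    ContMDiffOn 𝓘(ℝ, E) 𝓘(ℝ, E) ∞ (fun p ↦ (chartDeriv ψ p (Y p) : E)) (U ∩ ψ.source) := by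
  have h1 := (contMDiffOn_of_mem_maximalAtlas hψ).contMDiffOn_tangentMapWithin (m := ∞)
    (by simp) ψ.open_source.uniqueMDiffOn
  have h2 := h1.comp (hY.mono (inter_subset_left (t := ψ.source))) (fun p hp ↦ hp.2)
  have h3 := (contMDiff_snd_tangentBundle_modelSpace E 𝓘(ℝ, E)).comp_contMDiffOn h2
  refine h3.congr fun p hp ↦ ?_
  have h4 : mfderivWithin 𝓘(ℝ, E) 𝓘(ℝ, E) ψ ψ.source p = chartDeriv (E := E) ψ p :=
    mfderivWithin_of_mem_nhds (ψ.open_source.mem_nhds hp.2)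
  exact (DFunLike.congr_fun h4 (Y p)).symm

/-- A vector field along a map is smooth if its components in some chart are. -/
theorem contMDiffAt_of_chartSymmDeriv {E' : Type*} [NormedAddCommGroup E'] [NormedSpace ℝ E']
    {N : Type*} [TopologicalSpace N] [ChartedSpace E' N]
    (hψ : ψ ∈ IsManifold.maximalAtlas 𝓘(ℝ, E) ∞ M) {y W : N → E} {q : N} (hq : y q ∈ ψ.target)
    (hy : ContMDiffAt 𝓘(ℝ, E') 𝓘(ℝ, E) ∞ y q) (hW : ContMDiffAt 𝓘(ℝ, E') 𝓘(ℝ, E) ∞ W q) :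
    ContMDiffAt 𝓘(ℝ, E') 𝓘(ℝ, E).tangent ∞
      (fun p ↦ (⟨ψ.symm (y p), chartSymmDeriv ψ (y p) (W p)⟩ : TangentBundle 𝓘(ℝ, E) M)) q := by
  have h1 := (contMDiffOn_symm_of_mem_maximalAtlas hψ).contMDiffOn_tangentMapWithin (m := ∞)
    (by simp) ψ.open_target.uniqueMDiffOn
  have h2 : ContMDiffAt 𝓘(ℝ, E') 𝓘(ℝ, E).tangent ∞
      (fun p ↦ (⟨y p, W p⟩ : TangentBundle 𝓘(ℝ, E) E)) q := by
    rw [Bundle.contMDiffAt_totalSpace]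
    exact ⟨hy, by simpa using! hW⟩
  have h4 := (h1.contMDiffAt ((ψ.open_target.preimage
    (FiberBundle.continuous_proj E (TangentSpace 𝓘(ℝ, E)))).mem_nhds
      (show (⟨y q, W q⟩ : TangentBundle 𝓘(ℝ, E) E) ∈ _ from hq))).comp q h2
  refine h4.congr_of_eventuallyEq ?_
  filter_upwards [hy.continuousAt.eventually (ψ.open_target.mem_nhds hq)] with p hp
  simp only [Function.comp_apply, tangentMapWithin]
  congr 1
  rw [mfderivWithin_of_mem_nhds (ψ.open_target.mem_nhds hp)]
  rfl

end Bundle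

/-! ### Slice charts of an immersion -/

section Slice

variable {E : Type*} [NormedAddCommGroup E] [NormedSpace ℝ E]
  {M : Type*} [TopologicalSpace M] [ChartedSpace E M]
  {E' : Type*} [NormedAddCommGroup E'] [NormedSpace ℝ E']
  {N : Type*} [TopologicalSpace N] [ChartedSpace E' N]

/-- Charts `φ` of `N` and `ψ` of `M` in which `f` is the linear embedding `ι`, with left inverse
`π`. -/
structure IsSlice (f : N → M) (φ : OpenPartialHomeomorph N E') (ψ : OpenPartialHomeomorph M E)
    (ι : E' →L[ℝ] E) (π : E →L[ℝ] E') : Prop where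
  dom_mem : φ ∈ IsManifold.maximalAtlas 𝓘(ℝ, E') ∞ N
  cod_mem : ψ ∈ IsManifold.maximalAtlas 𝓘(ℝ, E) ∞ M
  mapsTo : MapsTo f φ.source ψ.source
  left_inv : ∀ u, π (ι u) = u
  apply_eq : ∀ p ∈ φ.source, ψ (f p) = ι (φ p)

/-- The normal form of an immersion is `u ↦ (u, 0)` followed by a linear equivalence; `ι` is that
composite and `π` undoes the equivalence and takes the first component. -/
theorem exists_isSlice {f : N → M} (hf : Manifold.IsImmersion 𝓘(ℝ, E') 𝓘(ℝ, E) ∞ f) (q : N) :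
    ∃ (φ : OpenPartialHomeomorph N E') (ψ : OpenPartialHomeomorph M E) (ι : E' →L[ℝ] E)
      (π : E →L[ℝ] E'), q ∈ φ.source ∧ IsSlice f φ ψ ι π := by
  obtain ⟨F, _, _, h⟩ := hf.isImmersionAt q
  refine ⟨h.domChart, h.codChart, (h.equiv : (E' × F) →L[ℝ] E).comp (.inl ℝ E' F),
    (ContinuousLinearMap.fst ℝ E' F).comp (h.equiv.symm : E →L[ℝ] E' × F),
    h.mem_domChart_source, h.domChart_mem_maximalAtlas, h.codChart_mem_maximalAtlas,
    h.source_subset_preimage_source, fun u ↦ by simp, fun p hp ↦ ?_⟩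
  have := h.writtenInCharts
    (show h.domChart p ∈ (h.domChart.extend 𝓘(ℝ, E')).target by simp [hp])
  simpa [hp] using this

/-- The projection onto the kernel of `π` along the range of `ι`. -/
def transversal (ι : E' →L[ℝ] E) (π : E →L[ℝ] E') : E →L[ℝ] E :=
  ContinuousLinearMap.id ℝ E - ι.comp π

theorem transversal_apply (ι : E' →L[ℝ] E) (π : E →L[ℝ] E') (e : E) :
    transversal ι π e = e - ι (π e) := rfl

namespace IsSlice

variable {f : N → M} {φ : OpenPartialHomeomorph N E'} {ψ : OpenPartialHomeomorph M E}
  {ι : E' →L[ℝ] E} {π : E →L[ℝ] E'} {p : N}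

theorem transversal_ι (hs : IsSlice f φ ψ ι π) (u : E') : transversal ι π (ι u) = 0 := by
  rw [transversal_apply, hs.left_inv, sub_self]

theorem transversal_transversal (hs : IsSlice f φ ψ ι π) (e : E) :
    transversal ι π (transversal ι π e) = transversal ι π e := by
  conv_lhs => rw [transversal_apply ι π e, map_sub, hs.transversal_ι, sub_zero]

theorem transversal_normalPart (hs : IsSlice f φ ψ ι π) (B : E →L[ℝ] E →L[ℝ] ℝ) (w : E) :
    transversal ι π (normalPart ι B w) = transversal ι π w := by
  rw [normalPart, map_sub, hs.transversal_ι, sub_zero]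

theorem contMDiffAt (hs : IsSlice f φ ψ ι π) (hp : p ∈ φ.source) : ContMDiffAt 𝓘(ℝ, E') 𝓘(ℝ, E) ∞ f p := by
  have h1 : ContMDiffAt 𝓘(ℝ, E') 𝓘(ℝ, E) ∞ (fun p ↦ ι (φ p)) p :=
    ι.contMDiff.contMDiffAt.comp p (contMDiffAt_of_mem_maximalAtlas hs.dom_mem hp)
  have h2 : ContMDiffAt 𝓘(ℝ, E') 𝓘(ℝ, E) ∞ (fun p ↦ ψ.symm (ι (φ p))) p := by
    refine ContMDiffAt.comp p (contMDiffAt_symm_of_mem_maximalAtlas hs.cod_mem ?_) h1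
    rw [← hs.apply_eq p hp]
    exact ψ.map_source (hs.mapsTo hp)
  refine h2.congr_of_eventuallyEq ?_
  filter_upwards [φ.open_source.mem_nhds hp] with p hp
  rw [← hs.apply_eq p hp, ψ.left_inv (hs.mapsTo hp)]

theorem mdifferentiableAt (hs : IsSlice f φ ψ ι π) (hp : p ∈ φ.source) : MDifferentiableAt 𝓘(ℝ, E') 𝓘(ℝ, E) f p :=
  (hs.contMDiffAt hp).mdifferentiableAt (by simp)

/-- Differentiate `ψ ∘ f = ι ∘ φ`, which holds near `p`. -/
theorem chartDeriv_modelDeriv (hs : IsSlice f φ ψ ι π) (hp : p ∈ φ.source) (v : E') :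
    chartDeriv ψ (f p) (modelDeriv f p v) = ι (chartDeriv φ p v) := by
  have h1 : HasMFDerivAt 𝓘(ℝ, E') 𝓘(ℝ, E) (fun p ↦ ψ (f p)) p
      ((chartDeriv ψ (f p)).comp (modelDeriv f p) : E' →L[ℝ] E) :=
    HasMFDerivAt.comp p (hasMFDerivAt_chart hs.cod_mem (hs.mapsTo hp))
      (hs.mdifferentiableAt hp).hasMFDerivAt
  have h2 : HasMFDerivAt 𝓘(ℝ, E') 𝓘(ℝ, E) (fun p ↦ ι (φ p)) p
      (ι.comp (chartDeriv φ p) : E' →L[ℝ] E) :=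
    HasMFDerivAt.comp p ι.hasFDerivAt.hasMFDerivAt (hasMFDerivAt_chart hs.dom_mem hp)
  have h3 := h2.congr_of_eventuallyEq (f₁ := fun p ↦ ψ (f p))
    (by filter_upwards [φ.open_source.mem_nhds hp] with p hp using hs.apply_eq p hp)
  exact DFunLike.congr_fun (hasMFDerivAt_unique h1 h3) v

/-- Lets equality of classes in the quotient by the tangent space be tested by `transversal`, whose
kernel is the range of `ι`. -/
theorem mem_tangentImage (hs : IsSlice f φ ψ ι π) (hp : p ∈ φ.source) (z : E) :
    (z : TangentSpace 𝓘(ℝ, E) (f p)) ∈ tangentImage E E' f p ↔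
      transversal ι π (chartDeriv ψ (f p) z) = 0 := by
  constructor
  · rintro ⟨v, hv⟩
    have : z = modelDeriv (E' := E') f p v := hv.symm
    rw [this]
    exact (congrArg _ (hs.chartDeriv_modelDeriv hp v)).trans (hs.transversal_ι _)
  · intro h
    refine ⟨chartSymmDeriv φ (φ p) (π (chartDeriv ψ (f p) z)), ?_⟩
    apply chartDeriv_injective hs.cod_mem (hs.mapsTo hp)
    refine (hs.chartDeriv_modelDeriv hp _).trans ?_
    rw [chartDeriv_chartSymmDeriv' hs.dom_mem hp]
    exact (sub_eq_zero.1 h).symm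

end IsSlice

end Slice

/-! ### Second fundamental form and umbilicity in slice charts -/

section Umbilic

variable {E : Type*} [NormedAddCommGroup E] [NormedSpace ℝ E]
  {M : Type*} [TopologicalSpace M] [ChartedSpace E M] [IsManifold 𝓘(ℝ, E) ∞ M]
  {E' : Type*} [NormedAddCommGroup E'] [NormedSpace ℝ E']
  {N : Type*} [TopologicalSpace N] [ChartedSpace E' N]
  {g : SemiRiemannianMetric E M} {f : N → M}
  {φ : OpenPartialHomeomorph N E'} {ψ : OpenPartialHomeomorph M E}
  {ι : E' →L[ℝ] E} {π : E →L[ℝ] E'} {p : N}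

theorem IsSlice.induced_apply (hs : IsSlice f φ ψ ι π) (hp : p ∈ φ.source) (u v : E') :
    g.induced (E' := E') f p u v =
      g.metricIn ψ (ψ (f p)) (ι (chartDeriv φ p u)) (ι (chartDeriv φ p v)) := by
  rw [← hs.chartDeriv_modelDeriv hp, ← hs.chartDeriv_modelDeriv hp,
    g.metricIn_chartDeriv hs.cod_mem (hs.mapsTo hp)]
  rfl

/-- In slice charts, the metric induces a Lorentz form on the model space of a timelike
submanifold. -/
theorem IsSlice.isLorentzForm (hs : IsSlice f φ ψ ι π) (hp : p ∈ φ.source)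
    (hft : g.IsTimelike (E' := E') f) :
    IsLorentzForm (((g.metricIn ψ (ψ (f p))).bilinearComp ι ι).toLinearMap₁₂ :
      LinearMap.BilinForm ℝ E') := by
  obtain ⟨m, e, he⟩ := hft p
  let A : TangentSpace 𝓘(ℝ, E') p ≃ₗ[ℝ] E' :=
    ((mdifferentiable_of_mem_maximalAtlas hs.dom_mem).mfderiv hp).toLinearEquiv
  refine ⟨m, e.map A, fun i j ↦ (Eq.trans ?_ (he i j))⟩
  simp only [Module.Basis.map_apply]
  exact (hs.induced_apply (g := g) hp (e i) (e j)).symm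

theorem IsSlice.isInvertible_metricIn [FiniteDimensional ℝ E'] (hs : IsSlice f φ ψ ι π)
    (hp : p ∈ φ.source) (hft : g.IsTimelike (E' := E') f) :
    ((g.metricIn ψ (ψ (f p))).bilinearComp ι ι).IsInvertible :=
  isInvertible_of_nondegenerate fun _ hv ↦ (hs.isLorentzForm hp hft).eq_zero hv

/-- Supplies a tangent vector `ξ` by whose square one can divide, to solve the umbilicity relation
for the umbilic vector. -/
theorem IsSlice.exists_metricIn_ne_zero (hs : IsSlice f φ ψ ι π) (hp : p ∈ φ.source)
    (hft : g.IsTimelike (E' := E') f) :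
    ∃ ξ : E', g.metricIn ψ (ψ (f p)) (ι ξ) (ι ξ) ≠ 0 :=
  (hs.isLorentzForm hp hft).exists_apply_self_ne_zero

variable [FiniteDimensional ℝ E]

/-- The derivative of the components of a tangent field lies in the range of `ι` and is killed, so
only the tensorial Christoffel term survives. -/
theorem IsSlice.transversal_covDerivAlong (hs : IsSlice f φ ψ ι π) (hp : p ∈ φ.source)
    {Y : ∀ p : N, TangentSpace 𝓘(ℝ, E') p}
    (hY : MDifferentiableAt 𝓘(ℝ, E') 𝓘(ℝ, E') (fun q ↦ (chartDeriv φ q (Y q) : E')) p)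
    (v : E') :
    transversal ι π (chartDeriv ψ (f p)
      (g.covDerivAlong f (fun q ↦ mfderiv 𝓘(ℝ, E') 𝓘(ℝ, E) f q (Y q)) p v)) =
    transversal ι π (christ (g.metricIn ψ) (ψ (f p)) (ι (chartDeriv φ p v))
      (ι (chartDeriv φ p (Y p)))) := by
  obtain ⟨D, hD⟩ : ∃ D : E' →L[ℝ] E',
      HasMFDerivAt 𝓘(ℝ, E') 𝓘(ℝ, E') (fun q ↦ (chartDeriv φ q (Y q) : E')) p D :=
    ⟨_, hY.hasMFDerivAt⟩
  have h1 : HasMFDerivAt 𝓘(ℝ, E') 𝓘(ℝ, E) (fun q ↦ ι (chartDeriv φ q (Y q))) p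
      (ι.comp D : E' →L[ℝ] E) := HasMFDerivAt.comp p ι.hasFDerivAt.hasMFDerivAt hD
  have h2 := h1.congr_of_eventuallyEq
    (f₁ := fun q ↦ (chartDeriv ψ (f q) (mfderiv 𝓘(ℝ, E') 𝓘(ℝ, E) f q (Y q)) : E))
    (by filter_upwards [φ.open_source.mem_nhds hp] with q hq using
          hs.chartDeriv_modelDeriv hq (Y q))
  have h3 := g.chartDeriv_covDerivAlong hs.cod_mem (hs.mapsTo hp) (hs.mdifferentiableAt hp) h2 v
  refine (congrArg (transversal ι π) h3).trans ?_
  rw [map_add, ContinuousLinearMap.comp_apply, hs.transversal_ι, zero_add]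
  exact congrArg (transversal ι π) (congrArg₂ (fun a b ↦ christ (g.metricIn ψ) (ψ (f p)) a b)
    (hs.chartDeriv_modelDeriv hp v) (hs.chartDeriv_modelDeriv hp (Y p)))

theorem IsSlice.secondFundamentalForm_eq_mk_iff (hs : IsSlice f φ ψ ι π) (hp : p ∈ φ.source)
    {X Y : ∀ p : N, TangentSpace 𝓘(ℝ, E') p}
    (hY : MDifferentiableAt 𝓘(ℝ, E') 𝓘(ℝ, E') (fun q ↦ (chartDeriv φ q (Y q) : E')) p) (z : E) :
    g.secondFundamentalForm f X Y p = Submodule.Quotient.mk (z : TangentSpace 𝓘(ℝ, E) (f p)) ↔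
      transversal ι π (christ (g.metricIn ψ) (ψ (f p)) (ι (chartDeriv φ p (X p)))
        (ι (chartDeriv φ p (Y p)))) = transversal ι π (chartDeriv ψ (f p) z) := by
  refine (Submodule.Quotient.eq _).trans ((hs.mem_tangentImage hp _).trans ?_)
  rw [← hs.transversal_covDerivAlong hp hY (X p)]
  have key : ∀ a b : E, transversal ι π (chartDeriv ψ (f p) (a - b)) = 0 ↔
      transversal ι π (chartDeriv ψ (f p) a) = transversal ι π (chartDeriv ψ (f p) b) :=
    fun a b ↦ by rw [map_sub, map_sub, sub_eq_zero]
  exact key _ z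

/-- The value at `p` of a vector field satisfying the umbilicity condition. -/
def SemiRiemannianMetric.IsUmbilicAt (g : SemiRiemannianMetric E M) (f : N → M)
    [IsManifold 𝓘(ℝ, E') ∞ N] (p : N) (z : TangentSpace 𝓘(ℝ, E) (f p)) : Prop :=
  ∀ (U : Set N) (X Y : ∀ p : N, TangentSpace 𝓘(ℝ, E') p), IsOpen U →
    ContMDiffOn 𝓘(ℝ, E') 𝓘(ℝ, E').tangent ∞
      (fun p ↦ (⟨p, X p⟩ : TangentBundle 𝓘(ℝ, E') N)) U →
    ContMDiffOn 𝓘(ℝ, E') 𝓘(ℝ, E').tangent ∞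
      (fun p ↦ (⟨p, Y p⟩ : TangentBundle 𝓘(ℝ, E') N)) U →
    p ∈ U → g.secondFundamentalForm f X Y p =
      Submodule.Quotient.mk (g.induced f p (X p) (Y p) • z)

variable [IsManifold 𝓘(ℝ, E') ∞ N]

/-- The umbilicity condition at a point, in slice charts. -/
theorem IsSlice.isUmbilicAt_iff (hs : IsSlice f φ ψ ι π) (hp : p ∈ φ.source) (z : E) :
    g.IsUmbilicAt (E' := E') f p z ↔ ∀ ξ η : E',
      transversal ι π (christ (g.metricIn ψ) (ψ (f p)) (ι ξ) (ι η)) =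
        g.metricIn ψ (ψ (f p)) (ι ξ) (ι η) • transversal ι π (chartDeriv ψ (f p) z) := by
  constructor
  · intro h ξ η
    -- The test fields are the coordinate fields of `φ` with constant components `ξ`.
    have hX : ∀ ξ : E', ContMDiffOn 𝓘(ℝ, E') 𝓘(ℝ, E').tangent ∞
        (fun p ↦ (⟨p, chartSymmDeriv φ (φ p) ξ⟩ : TangentBundle 𝓘(ℝ, E') N)) φ.source := by
      intro ξ
      refine ((contMDiffOn_chartSymmDeriv_section hs.dom_mem ξ).comp
        (contMDiffOn_of_mem_maximalAtlas hs.dom_mem) φ.mapsTo).congr fun q hq ↦ ?_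
      refine tangentBundle_ext hs.dom_mem (φ.left_inv hq).symm hq ?_
      simp only [Function.comp_apply]
      exact congrArg (fun x ↦ chartDeriv φ x (chartSymmDeriv φ (φ q) ξ)) (φ.left_inv hq).symm
    have h1 := h φ.source _ _ φ.open_source (hX ξ) (hX η) hp
    have hY : MDifferentiableAt 𝓘(ℝ, E') 𝓘(ℝ, E')
        (fun q ↦ (chartDeriv φ q (chartSymmDeriv φ (φ q) η) : E')) p :=
      ((contMDiffOn_chartDeriv hs.dom_mem (hX η)).contMDiffAt
        ((φ.open_source.inter φ.open_source).mem_nhds ⟨hp, hp⟩)).mdifferentiableAt (by simp)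
    have h2 := (hs.secondFundamentalForm_eq_mk_iff hp hY _).1 h1
    rw [chartDeriv_chartSymmDeriv' hs.dom_mem hp, chartDeriv_chartSymmDeriv' hs.dom_mem hp] at h2
    rw [h2]
    have h3 : g.induced (E' := E') f p (chartSymmDeriv φ (φ p) ξ) (chartSymmDeriv φ (φ p) η) =
        g.metricIn ψ (ψ (f p)) (ι ξ) (ι η) := by
      rw [hs.induced_apply hp, chartDeriv_chartSymmDeriv' hs.dom_mem hp,
        chartDeriv_chartSymmDeriv' hs.dom_mem hp]
    rw [← h3]
    exact (congrArg _ (map_smul (chartDeriv ψ (f p)) _ z)).trans (map_smul (transversal ι π) _ _)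
  · intro h U X Y hU hX hY hpU
    have hY' : MDifferentiableAt 𝓘(ℝ, E') 𝓘(ℝ, E') (fun q ↦ (chartDeriv φ q (Y q) : E')) p :=
      ((contMDiffOn_chartDeriv hs.dom_mem hY).contMDiffAt
        ((hU.inter φ.open_source).mem_nhds ⟨hpU, hp⟩)).mdifferentiableAt (by simp)
    refine (hs.secondFundamentalForm_eq_mk_iff hp hY' _).2 ?_
    rw [h]
    refine (congrArg (fun c : ℝ ↦ c • transversal ι π (chartDeriv ψ (f p) z))
      (hs.induced_apply (g := g) hp (X p) (Y p)).symm).trans ?_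
    exact ((congrArg _ (map_smul (chartDeriv ψ (f p)) _ z)).trans
      (map_smul (transversal ι π) _ _)).symm

end Umbilic

/-! ### Geodesics near an umbilic slice, and local existence -/

section Local

variable {E E' : Type*} [NormedAddCommGroup E] [NormedSpace ℝ E] [FiniteDimensional ℝ E]
  [NormedAddCommGroup E'] [NormedSpace ℝ E']
  {G : E → E →L[ℝ] E →L[ℝ] ℝ} {Ω : Set E} {ι : E' →L[ℝ] E} {π : E →L[ℝ] E'}

/-- A lightlike solution of the geodesic equation that starts tangent to the range of `ι` stays in
it, if the range of `ι` is umbilic. -/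
theorem eventually_transversal_eq_zero (hΩ : IsOpen Ω) (hG : ContDiffOn ℝ ∞ G Ω)
    (hinv : ∀ y ∈ Ω, (G y).IsInvertible) {x w : ℝ → E} {t₀ : ℝ} (hxΩ : x t₀ ∈ Ω)
    (hx : ∀ᶠ t in 𝓝 t₀, HasDerivAt x (w t) t)
    (hw : ∀ᶠ t in 𝓝 t₀, HasDerivAt w (-christ G (x t) (w t) (w t)) t)
    (hnull : ∀ᶠ t in 𝓝 t₀, G (x t) (w t) (w t) = 0)
    (hx0 : transversal ι π (x t₀) = 0) (hw0 : transversal ι π (w t₀) = 0)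
    {ξ : E'} (hξ : G (x t₀) (ι ξ) (ι ξ) ≠ 0)
    (humb : ∀ᶠ u in 𝓝 (π (x t₀)), ∃ ζ : E, ∀ η : E',
      transversal ι π (christ G (ι u) (ι η) (ι η)) = G (ι u) (ι η) (ι η) • ζ) :
    ∀ᶠ t in 𝓝 t₀, transversal ι π (x t) = 0 := by
  have hΓ := contDiffOn_christ hΩ hG hinv
  have hGc : ContDiffAt ℝ ∞ G (x t₀) := hG.contDiffAt (hΩ.mem_nhds hxΩ)
  have hΓc : ContDiffAt ℝ ∞ (christ G) (x t₀) := hΓ.contDiffAt (hΩ.mem_nhds hxΩ)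
  -- On the slice, umbilicity forces the transversal part of `ζ` wherever it matters to be Γ(ξ, ξ)
  -- divided by the square of `ξ`; this formula also makes sense off the slice. So `Θ` vanishes at
  -- tangent states over the slice, and at null velocities it is the transversal part of Γ.
  let Θ : E × E → E := fun q ↦ transversal ι π (christ G q.1 q.2 q.2) -
    G q.1 q.2 q.2 • ((G q.1 (ι ξ) (ι ξ))⁻¹ • transversal ι π (christ G q.1 (ι ξ) (ι ξ)))
  have hΘ : ContDiffAt ℝ 1 Θ (x t₀, w t₀) := by
    have h1 : ContDiffAt ℝ ∞ (fun q : E × E ↦ G q.1) (x t₀, w t₀) :=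
      ContDiffAt.comp (x t₀, w t₀) (by exact hGc) contDiffAt_fst
    have h2 : ContDiffAt ℝ ∞ (fun q : E × E ↦ christ G q.1) (x t₀, w t₀) :=
      ContDiffAt.comp (x t₀, w t₀) (by exact hΓc) contDiffAt_fst
    have h3 : ContDiffAt ℝ ∞ Θ (x t₀, w t₀) := by
      refine (contDiffAt_const.clm_apply ((h2.clm_apply contDiffAt_snd).clm_apply
        contDiffAt_snd)).sub (((h1.clm_apply contDiffAt_snd).clm_apply contDiffAt_snd).smul ?_)
      exact (((h1.clm_apply contDiffAt_const).clm_apply contDiffAt_const).inv hξ).smul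
        (contDiffAt_const.clm_apply
          ((h2.clm_apply contDiffAt_const).clm_apply contDiffAt_const))
    exact h3.of_le (WithTop.coe_le_coe.2 le_top)
  obtain ⟨K, s, hs, hK⟩ := hΘ.exists_lipschitzOnWith
  have hxc : ContinuousAt x t₀ := hx.self_of_nhds.continuousAt
  have hwc : ContinuousAt w t₀ := hw.self_of_nhds.continuousAt
  have hιx : ι (π (x t₀)) = x t₀ := (sub_eq_zero.1 hx0).symm
  have hιw : ι (π (w t₀)) = w t₀ := (sub_eq_zero.1 hw0).symm
  have hxc' : Tendsto (fun t ↦ ι (π (x t))) (𝓝 t₀) (𝓝 (x t₀)) := by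
    have : ContinuousAt (fun t ↦ ι (π (x t))) t₀ :=
      ι.continuous.continuousAt.comp (π.continuous.continuousAt.comp hxc)
    rwa [ContinuousAt, hιx] at this
  have hwc' : Tendsto (fun t ↦ ι (π (w t))) (𝓝 t₀) (𝓝 (w t₀)) := by
    have : ContinuousAt (fun t ↦ ι (π (w t))) t₀ :=
      ι.continuous.continuousAt.comp (π.continuous.continuousAt.comp hwc)
    rwa [ContinuousAt, hιw] at this
  have e1 : ∀ᶠ t in 𝓝 t₀, (x t, w t) ∈ s := (hxc.prodMk_nhds hwc).eventually hs
  have e2 : ∀ᶠ t in 𝓝 t₀, (ι (π (x t)), ι (π (w t))) ∈ s := (hxc'.prodMk_nhds hwc').eventually hs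
  have e3 : ∀ᶠ t in 𝓝 t₀, G (ι (π (x t))) (ι ξ) (ι ξ) ≠ 0 := by
    have : ContinuousAt (fun y ↦ G y (ι ξ) (ι ξ)) (x t₀) :=
      (hGc.continuousAt.clm_apply continuousAt_const).clm_apply continuousAt_const
    exact hxc'.eventually (this.eventually_ne hξ)
  have e4 : ∀ᶠ t in 𝓝 t₀, ∃ ζ : E, ∀ η : E',
      transversal ι π (christ G (ι (π (x t))) (ι η) (ι η)) =
        G (ι (π (x t))) (ι η) (ι η) • ζ :=
    (π.continuous.continuousAt.comp hxc).eventually humb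
  obtain ⟨ε, hε, hball⟩ := Metric.eventually_nhds_iff_ball.1
    ((hx.and hw).and ((hnull.and e1).and ((e2.and e3).and e4)))
  rw [Real.ball_eq_Ioo] at hball
  have hfin := eq_zero_of_norm_second_deriv_le (z := fun t ↦ transversal ι π (x t))
    (w := fun t ↦ transversal ι π (w t))
    (a := fun t ↦ transversal ι π (-christ G (x t) (w t) (w t))) (K := K) (ε := ε) (t₀ := t₀)
    hx0 hw0 (fun t ht ↦ (transversal ι π).hasFDerivAt.comp_hasDerivAt t (hball t ht).1.1)
    (fun t ht ↦ (transversal ι π).hasFDerivAt.comp_hasDerivAt t (hball t ht).1.2)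
    (fun t ht ↦ by
      obtain ⟨⟨-, -⟩, ⟨hn, h1⟩, ⟨h2, h3⟩, ζ, h4⟩ := hball t ht
      -- The state is compared with its projection to the slice, where `Θ` vanishes. Their
      -- difference is the pair of transversal parts, so the Lipschitz bound for `Θ` is the estimate
      -- needed.
      have hz : Θ (ι (π (x t)), ι (π (w t))) = 0 := by
        simp only [Θ]
        rw [h4, h4, inv_smul_smul₀ h3, sub_self]
      have hz' : Θ (x t, w t) = transversal ι π (christ G (x t) (w t) (w t)) := by
        simp only [Θ]
        rw [hn, zero_smul, sub_zero]
      have := hK.norm_sub_le h1 h2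
      rw [hz, hz', sub_zero] at this
      rw [map_neg, norm_neg]
      exact this)
  have : Ioo (t₀ - ε) (t₀ + ε) ∈ 𝓝 t₀ := Ioo_mem_nhds (by linarith) (by linarith)
  filter_upwards [this] with t ht using hfin t ht

/-- Local existence for the geodesic equation. -/
theorem exists_geodesic_equation (hΩ : IsOpen Ω) (hG : ContDiffOn ℝ ∞ G Ω)
    (hinv : ∀ y ∈ Ω, (G y).IsInvertible) {y : E} (hy : y ∈ Ω) (v : E) :
    ∃ ε > (0 : ℝ), ∃ x w : ℝ → E, x 0 = y ∧ w 0 = v ∧ ∀ t ∈ Ioo (-ε) ε, x t ∈ Ω ∧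
      HasDerivAt x (w t) t ∧ HasDerivAt w (-christ G (x t) (w t) (w t)) t := by
  have : CompleteSpace E := FiniteDimensional.complete ℝ E
  have hΓc : ContDiffAt ℝ ∞ (christ G) y :=
    (contDiffOn_christ hΩ hG hinv).contDiffAt (hΩ.mem_nhds hy)
  have hF : ContDiffAt ℝ 1 (fun q : E × E ↦ (q.2, -christ G q.1 q.2 q.2)) (y, v) := by
    have h2 : ContDiffAt ℝ ∞ (fun q : E × E ↦ christ G q.1) (y, v) :=
      ContDiffAt.comp (y, v) (by exact hΓc) contDiffAt_fst
    exact (contDiffAt_snd.prodMk ((h2.clm_apply contDiffAt_snd).clm_apply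
      contDiffAt_snd).neg).of_le (WithTop.coe_le_coe.2 le_top)
  -- Picard–Lindelöf for the first-order system in position and velocity.
  obtain ⟨α, hα0, δ, hδ, hα⟩ :=
    hF.exists_forall_mem_closedBall_exists_eq_forall_mem_Ioo_hasDerivAt₀ 0
  have hx : ∀ t ∈ Ioo (0 - δ) (0 + δ), HasDerivAt (fun t ↦ (α t).1) (α t).2 t := fun t ht ↦
    (hα t ht).fst
  have hw : ∀ t ∈ Ioo (0 - δ) (0 + δ),
      HasDerivAt (fun t ↦ (α t).2) (-christ G (α t).1 (α t).2 (α t).2) t := fun t ht ↦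
    (hα t ht).snd
  have h0 : (0 : ℝ) ∈ Ioo (0 - δ) (0 + δ) := by constructor <;> linarith
  have e1 : ∀ᶠ t in 𝓝 (0 : ℝ), (α t).1 ∈ Ω :=
    (hx 0 h0).continuousAt.eventually (by simpa [hα0] using hΩ.mem_nhds hy)
  obtain ⟨ε, hε, hball⟩ := Metric.eventually_nhds_iff_ball.1
    (e1.and (Ioo_mem_nhds h0.1 h0.2))
  rw [Real.ball_eq_Ioo, zero_sub, zero_add] at hball
  exact ⟨ε, hε, fun t ↦ (α t).1, fun t ↦ (α t).2, by simp [hα0], by simp [hα0], fun t ht ↦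
    ⟨(hball t ht).1, hx t (hball t ht).2, hw t (hball t ht).2⟩⟩

end Local

/-! ### The two implications -/

section Main

variable {E : Type*} [NormedAddCommGroup E] [NormedSpace ℝ E] [FiniteDimensional ℝ E]
  {M : Type*} [TopologicalSpace M] [ChartedSpace E M] [IsManifold 𝓘(ℝ, E) ∞ M]
  {E' : Type*} [NormedAddCommGroup E'] [NormedSpace ℝ E']
  {N : Type*} [TopologicalSpace N] [ChartedSpace E' N]
  {g : SemiRiemannianMetric E M} {f : N → M}
  {φ : OpenPartialHomeomorph N E'} {ψ : OpenPartialHomeomorph M E}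
  {ι : E' →L[ℝ] E} {π : E →L[ℝ] E'} {p : N}

/-- A totally umbilic timelike submanifold is a photon surface. -/
theorem SemiRiemannianMetric.IsTotallyUmbilic.isPhotonSurface [IsManifold 𝓘(ℝ, E') ∞ N]
    (hf : Manifold.IsImmersion 𝓘(ℝ, E') 𝓘(ℝ, E) ∞ f) (hft : g.IsTimelike (E' := E') f)
    (h : g.IsTotallyUmbilic (E' := E') f) : g.IsPhotonSurface (E' := E') f := by
  obtain ⟨Z, -, hZ⟩ := h
  have hZ' : ∀ p, g.IsUmbilicAt (E' := E') f p (Z p) := fun p U X Y hU hX hY hp ↦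
    hZ U X Y hU hX hY p hp
  intro γ a b hγ hlight t₀ ht₀ q v hqv
  obtain ⟨φ, ψ, ι, π, hq, hs⟩ := exists_isSlice hf q
  have hqγ : f q = γ t₀ := congrArg Bundle.TotalSpace.proj hqv
  have hdv : chartDeriv ψ (f q) (modelDeriv (E' := E') f q v) =
      chartDeriv ψ (γ t₀) (velocity (E := E) γ t₀) :=
    congrArg (fun P : TangentBundle 𝓘(ℝ, E) M ↦ (chartDeriv ψ P.1 P.2 : E)) hqv
  have hγ₀ : γ t₀ ∈ ψ.source := hqγ ▸ hs.mapsTo hq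
  have hIoo : Ioo a b ∈ 𝓝 t₀ := Ioo_mem_nhds ht₀.1 ht₀.2
  have hcont : ContinuousAt γ t₀ := (hγ.mdifferentiableAt ht₀).continuousAt
  have hsrc : ∀ᶠ t in 𝓝 t₀, γ t ∈ ψ.source :=
    hcont.eventually (ψ.open_source.mem_nhds hγ₀)
  have hx₀ : ψ (γ t₀) = ι (φ q) := by rw [← hqγ, hs.apply_eq q hq]
  obtain ⟨ξ, hξ⟩ := hs.exists_metricIn_ne_zero hq hft
  have hev := eventually_transversal_eq_zero (G := g.metricIn ψ) (ι := ι) (π := π)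
    (x := fun t ↦ ψ (γ t)) (w := fun t ↦ chartDeriv ψ (γ t) (velocity (E := E) γ t))
    (t₀ := t₀) ψ.open_target (g.contDiffOn_metricIn hs.cod_mem)
    (fun y hy ↦ g.isInvertible_metricIn hs.cod_mem hy) (ψ.map_source hγ₀)
    (by
      filter_upwards [hIoo, hsrc] with t ht ht'
      exact hasDerivAt_chart_comp hs.cod_mem (hγ.mdifferentiableAt ht) ht')
    (by
      filter_upwards [hIoo, hsrc] with t ht ht'
      exact hγ.hasDerivAt_chart hs.cod_mem ht ht')
    (by
      filter_upwards [hIoo, hsrc] with t ht ht'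
      exact (g.metricIn_chartDeriv hs.cod_mem ht' _ _).trans (hlight t ht))
    (by rw [hx₀, hs.transversal_ι])
    (by
      rw [← hdv]
      exact (congrArg _ (hs.chartDeriv_modelDeriv hq v)).trans (hs.transversal_ι _))
    (ξ := ξ) (by rwa [← hqγ])
    (by
      -- Slice points `ι u` near the start are images of the points `φ.symm u`, where umbilicity
      -- applies.
      rw [hx₀, hs.left_inv]
      filter_upwards [φ.open_target.mem_nhds (φ.map_source hq)] with u hu
      have hu' : ψ (f (φ.symm u)) = ι u := by
        rw [hs.apply_eq _ (φ.map_target hu), φ.right_inv hu]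
      refine ⟨transversal ι π (chartDeriv ψ (f (φ.symm u)) (Z (φ.symm u))), fun η ↦ ?_⟩
      have := (hs.isUmbilicAt_iff (φ.map_target hu) (Z (φ.symm u))).1 (hZ' (φ.symm u)) η η
      rwa [hu'] at this)
  have hπ : ContinuousAt (fun t ↦ π (ψ (γ t))) t₀ :=
    π.continuous.continuousAt.comp ((ψ.continuousAt hγ₀).comp hcont)
  have htgt : ∀ᶠ t in 𝓝 t₀, π (ψ (γ t)) ∈ φ.target := hπ.eventually (φ.open_target.mem_nhds (by
    simpa only [hx₀, hs.left_inv] using φ.map_source hq))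
  obtain ⟨ε, hε, hball⟩ := Metric.eventually_nhds_iff_ball.1
    ((hev.and hsrc).and ((show ∀ᶠ t in 𝓝 t₀, t ∈ Ioo a b from hIoo).and htgt))
  rw [Real.ball_eq_Ioo] at hball
  -- The lift reads the slice coordinates of the geodesic back through `φ`; it lies over `γ` because
  -- the transversal coordinates vanish.
  refine ⟨ε, hε, fun t ↦ φ.symm (π (ψ (γ t))), fun t ht ↦ ?_, ?_, fun t ht ↦ ?_⟩
  · obtain ⟨⟨-, h2⟩, h3, h4⟩ := hball t ht
    exact ((φ.symm.continuousAt h4).comp (f := fun t ↦ π (ψ (γ t))) (π.continuous.continuousAt.comp (f := fun t ↦ ψ (γ t)) ((ψ.continuousAt h2).comp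
      (hγ.mdifferentiableAt h3).continuousAt))).continuousWithinAt
  · simp only [hx₀, hs.left_inv, φ.left_inv hq]
  · obtain ⟨⟨h1, h2⟩, h3, h4⟩ := hball t ht
    have hc := φ.map_target h4
    apply ψ.injOn (hs.mapsTo hc) h2
    rw [hs.apply_eq _ hc, φ.right_inv h4]
    exact (sub_eq_zero.1 h1).symm

/-- The second fundamental form of a photon surface vanishes on lightlike vectors. -/
theorem IsSlice.transversal_christ_eq_zero (hs : IsSlice f φ ψ ι π) (hp : p ∈ φ.source)
    (h : g.IsPhotonSurface (E' := E') f) {ξ : E'}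
    (hξ : g.metricIn ψ (ψ (f p)) (ι ξ) (ι ξ) = 0) :
    transversal ι π (christ (g.metricIn ψ) (ψ (f p)) (ι ξ) (ι ξ)) = 0 := by
  have hinv := fun y hy ↦ g.isInvertible_metricIn hs.cod_mem (y := y) hy
  have hG := g.contDiffOn_metricIn hs.cod_mem
  obtain ⟨ε, hε, x, w, hx0, hw0, hxw⟩ := exists_geodesic_equation ψ.open_target hG hinv
    (ψ.map_source (hs.mapsTo hp)) (ι ξ)
  have h0 : (0 : ℝ) ∈ Ioo (-ε) ε := ⟨by linarith, hε⟩
  obtain ⟨hgeo, hvel⟩ := g.isGeodesicOn_of_hasDerivAt (a := -ε) (b := ε) hs.cod_mem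
    (fun t ht ↦ (hxw t ht).1) (fun t ht ↦ (hxw t ht).2.1) (fun t ht ↦ (hxw t ht).2.2)
  have hnull : ∀ t ∈ Ioo (-ε) ε, g.metricIn ψ (x t) (w t) (w t) = 0 := by
    intro t ht
    -- The energy has zero derivative, hence `K = 0`: a geodesic that starts null stays null.
    refine eq_zero_of_norm_deriv_le (z := fun t ↦ g.metricIn ψ (x t) (w t) (w t))
      (z' := fun _ ↦ 0) (K := 0) (ε := ε) (t₀ := 0) (by rw [hx0, hw0, hξ]) (fun s hs' ↦ ?_)
      (fun s hs' ↦ by simp) t (by simpa using ht)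
    obtain ⟨h1, h2, h3⟩ := hxw s (by simpa using hs')
    exact hasDerivAt_energy ((hG.contDiffAt (ψ.open_target.mem_nhds h1)).differentiableAt
      (by simp)) (fun v w ↦ g.metricIn_symm _ _ _) (hinv _ h1) h2 h3
  have hlight : g.IsLightlikeOn (fun t ↦ ψ.symm (x t)) (-ε) ε := by
    intro t ht
    have h1 := g.metricIn_chartDeriv hs.cod_mem (ψ.map_target (hxw t ht).1)
      (velocity (E := E) (fun t ↦ ψ.symm (x t)) t) (velocity (E := E) (fun t ↦ ψ.symm (x t)) t)
    rw [hvel t ht, ψ.right_inv (hxw t ht).1, hnull t ht] at h1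
    exact h1.symm
  have hx0' : ψ.symm (x 0) = f p := by rw [hx0, ψ.left_inv (hs.mapsTo hp)]
  obtain ⟨δ, hδ, c, hc, hc0, hfc⟩ := h _ (-ε) ε hgeo hlight 0 h0 p (chartSymmDeriv φ (φ p) ξ) (by
    refine tangentBundle_ext hs.cod_mem hx0'.symm (hs.mapsTo hp) ?_
    refine (hs.chartDeriv_modelDeriv hp _).trans ?_
    rw [chartDeriv_chartSymmDeriv' hs.dom_mem hp]
    exact hw0.symm.trans (hvel 0 h0).symm)
  have hIoo : Ioo (-ε) ε ∈ 𝓝 (0 : ℝ) := Ioo_mem_nhds h0.1 h0.2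
  have hIoo' : Ioo (0 - δ) (0 + δ) ∈ 𝓝 (0 : ℝ) := Ioo_mem_nhds (by linarith) (by linarith)
  -- Continuity of the lift keeps it in the slice chart; mere membership of the geodesic in the
  -- image of `f` would not exclude other sheets.
  have hcsrc : ∀ᶠ t in 𝓝 (0 : ℝ), c t ∈ φ.source :=
    (hc.continuousAt hIoo').eventually (by rw [hc0]; exact φ.open_source.mem_nhds hp)
  have hz : ∀ᶠ t in 𝓝 (0 : ℝ), transversal ι π (x t) = 0 := by
    filter_upwards [hcsrc, hIoo, hIoo'] with t h1 h2 h3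
    rw [← ψ.right_inv (hxw t h2).1, ← hfc t h3, hs.apply_eq _ h1, hs.transversal_ι]
  have hzw : ∀ᶠ t in 𝓝 (0 : ℝ), transversal ι π (w t) = 0 := by
    filter_upwards [hz.eventually_nhds, hIoo] with t h1 h2
    have h3 := (transversal ι π).hasFDerivAt.comp_hasDerivAt t (hxw t h2).2.1
    exact h3.unique ((hasDerivAt_const t (0 : E)).congr_of_eventuallyEq h1)
  -- Second derivative of the vanishing transversal coordinates, evaluated by the geodesic equation.
  have h3 := (transversal ι π).hasFDerivAt.comp_hasDerivAt (0 : ℝ) (hxw 0 h0).2.2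
  have h4 := h3.unique ((hasDerivAt_const (0 : ℝ) (0 : E)).congr_of_eventuallyEq hzw)
  rwa [map_neg, neg_eq_zero, hx0, hw0] at h4

/-- At each point of a timelike photon surface there is a normal vector satisfying the umbilicity
condition. -/
theorem SemiRiemannianMetric.IsPhotonSurface.exists_isUmbilicAt [IsManifold 𝓘(ℝ, E') ∞ N]
    [FiniteDimensional ℝ E']
    (hf : Manifold.IsImmersion 𝓘(ℝ, E') 𝓘(ℝ, E) ∞ f) (hft : g.IsTimelike (E' := E') f)
    (h : g.IsPhotonSurface (E' := E') f) (p : N) :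
    ∃ z : TangentSpace 𝓘(ℝ, E) (f p), g.IsUmbilicAt (E' := E') f p z ∧
      ∀ v : E', g.modelVal (f p) z (modelDeriv f p v) = 0 := by
  obtain ⟨φ, ψ, ι, π, hp, hs⟩ := exists_isSlice hf p
  have hfp := hs.mapsTo hp
  set y := ψ (f p)
  have hsymm : ∀ a b : E, christ (g.metricIn ψ) y a b = christ (g.metricIn ψ) y b a := by
    intro a b
    have hinv := g.isInvertible_metricIn hs.cod_mem (ψ.map_source hfp)
    have hd : DifferentiableAt ℝ (g.metricIn ψ) y := ((g.contDiffOn_metricIn hs.cod_mem).contDiffAt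
      (ψ.open_target.mem_nhds (ψ.map_source hfp))).differentiableAt (by simp)
    exact christ_symm hd hinv (fun z ↦ g.metricIn_symm z) a b
  let β : E' →ₗ[ℝ] E' →ₗ[ℝ] E :=
    (((ContinuousLinearMap.compL ℝ E E E (transversal ι π)) ∘L
      christ (g.metricIn ψ) y).bilinearComp ι ι).toLinearMap₁₂
  have hβ : ∀ ξ η, β ξ η = transversal ι π (christ (g.metricIn ψ) y (ι ξ) (ι η)) :=
    fun ξ η ↦ rfl
  obtain ⟨ζ, hζ⟩ := (hs.isLorentzForm hp hft).exists_eq_smul β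
    (fun u v ↦ by rw [hβ, hβ, hsymm]) (fun v hv ↦ hs.transversal_christ_eq_zero hp h hv)
  have hζ' : ∀ ξ η : E', transversal ι π (christ (g.metricIn ψ) y (ι ξ) (ι η)) =
      g.metricIn ψ y (ι ξ) (ι η) • ζ := hζ
  have hninv := hs.isInvertible_metricIn (g := g) hp hft
  -- `ζ` matters only modulo tangent vectors, so it may be replaced by its normal part.
  refine ⟨chartSymmDeriv ψ y (normalPart ι (g.metricIn ψ y) ζ), ?_, fun v ↦ ?_⟩
  · refine (hs.isUmbilicAt_iff hp _).2 fun ξ η ↦ ?_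
    rw [chartDeriv_chartSymmDeriv' hs.cod_mem hfp, hs.transversal_normalPart, ← map_smul,
      ← hζ' ξ η, hs.transversal_transversal]
  · rw [← g.metricIn_chartDeriv hs.cod_mem hfp, chartDeriv_chartSymmDeriv' hs.cod_mem hfp,
      hs.chartDeriv_modelDeriv hp, apply_normalPart hninv]

/-- A timelike photon surface is totally umbilic. -/
theorem SemiRiemannianMetric.IsPhotonSurface.isTotallyUmbilic [IsManifold 𝓘(ℝ, E') ∞ N]
    [FiniteDimensional ℝ E']
    (hf : Manifold.IsImmersion 𝓘(ℝ, E') 𝓘(ℝ, E) ∞ f) (hft : g.IsTimelike (E' := E') f)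
    (h : g.IsPhotonSurface (E' := E') f) : g.IsTotallyUmbilic (E' := E') f := by
  choose Z hZ hZn using h.exists_isUmbilicAt hf hft
  refine ⟨Z, fun q ↦ ?_, fun U X Y hU hX hY p hp ↦ hZ p U X Y hU hX hY hp⟩
  obtain ⟨φ, ψ, ι, π, hq, hs⟩ := exists_isSlice hf q
  obtain ⟨ξ, hξ⟩ := hs.exists_metricIn_ne_zero hq hft
  have hyt : ψ (f q) ∈ ψ.target := ψ.map_source (hs.mapsTo hq)
  have hG : ContDiffAt ℝ ∞ (g.metricIn ψ) (ψ (f q)) :=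
    (g.contDiffOn_metricIn hs.cod_mem).contDiffAt (ψ.open_target.mem_nhds hyt)
  have hΓ : ContDiffAt ℝ ∞ (christ (g.metricIn ψ)) (ψ (f q)) :=
    (contDiffOn_christ ψ.open_target (g.contDiffOn_metricIn hs.cod_mem) fun y hy ↦
      g.isInvertible_metricIn hs.cod_mem hy).contDiffAt (ψ.open_target.mem_nhds hyt)
  have hGξ : ContDiffAt ℝ ∞ (fun y ↦ g.metricIn ψ y (ι ξ) (ι ξ)) (ψ (f q)) :=
    (hG.clm_apply contDiffAt_const).clm_apply contDiffAt_const
  -- Umbilicity on the pair (ξ, ξ) determines the class of the vector, and normality its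
  -- representative. This gives a formula for `Z` that is smooth while the square of `ξ` is nonzero.
  let ρ : E → E := fun y ↦ normalPart ι (g.metricIn ψ y)
    ((g.metricIn ψ y (ι ξ) (ι ξ))⁻¹ • christ (g.metricIn ψ) y (ι ξ) (ι ξ))
  have hρ : ContDiffAt ℝ ∞ ρ (ψ (f q)) := contDiffAt_normalPart hG
    ((hGξ.inv hξ).smul ((hΓ.clm_apply contDiffAt_const).clm_apply contDiffAt_const))
    (hs.isInvertible_metricIn hq hft)
  have hψf : ContMDiffAt 𝓘(ℝ, E') 𝓘(ℝ, E) ∞ (fun p ↦ ψ (f p)) q :=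
    (contMDiffAt_of_mem_maximalAtlas hs.cod_mem (hs.mapsTo hq)).comp q (hs.contMDiffAt hq)
  have hW : ContMDiffAt 𝓘(ℝ, E') 𝓘(ℝ, E) ∞ (fun p ↦ ρ (ψ (f p))) q :=
    ContMDiffAt.comp q (contMDiffAt_iff_contDiffAt.2 hρ) hψf
  refine (contMDiffAt_of_chartSymmDeriv (y := fun p ↦ ψ (f p)) (q := q) hs.cod_mem hyt hψf hW).congr_of_eventuallyEq ?_
  filter_upwards [φ.open_source.mem_nhds hq,
    hψf.continuousAt.eventually (hGξ.continuousAt.eventually_ne hξ)] with p hp hne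
  have hfp := hs.mapsTo hp
  refine tangentBundle_ext hs.cod_mem (ψ.left_inv hfp).symm hfp ?_
  have h1 : chartDeriv ψ (f p) (Z p) = ρ (ψ (f p)) := by
    have hL := (hs.isUmbilicAt_iff hp (Z p)).1 (hZ p) ξ ξ
    refine eq_normalPart (hs.isInvertible_metricIn hp hft) (η := π (chartDeriv ψ (f p) (Z p) -
      (g.metricIn ψ (ψ (f p)) (ι ξ) (ι ξ))⁻¹ •
        christ (g.metricIn ψ) (ψ (f p)) (ι ξ) (ι ξ))) ?_ fun v ↦ ?_
    · rw [← sub_eq_zero, ← transversal_apply, map_sub, map_smul, hL, inv_smul_smul₀ hne, sub_self]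
    · have hv : ∀ z : E, g.modelVal (f p) z (modelDeriv f p (chartSymmDeriv φ (φ p) v)) =
          g.metricIn ψ (ψ (f p)) (chartDeriv ψ (f p) z) (ι v) := fun z ↦ by
        rw [← g.metricIn_chartDeriv hs.cod_mem hfp, hs.chartDeriv_modelDeriv hp,
          chartDeriv_chartSymmDeriv' hs.dom_mem hp]
      exact (hv (Z p)).symm.trans (hZn p _)
  refine h1.trans ?_
  exact (chartDeriv_chartSymmDeriv hs.cod_mem (ψ.map_source hfp) _).symm

end Main

end SemiRiem

end

theorem mainTheorem1
    {E : Type*} [NormedAddCommGroup E] [NormedSpace ℝ E] [FiniteDimensional ℝ E]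
    {M : Type*} [TopologicalSpace M] [ChartedSpace E M] [IsManifold 𝓘(ℝ, E) ∞ M]
    {E' : Type*} [NormedAddCommGroup E'] [NormedSpace ℝ E'] [FiniteDimensional ℝ E']
    {N : Type*} [TopologicalSpace N] [ChartedSpace E' N] [IsManifold 𝓘(ℝ, E') ∞ N]
    (g : SemiRiem.SemiRiemannianMetric E M) (hg : g.IsLorentzian)
    (f : N → M) (hf : Manifold.IsImmersion 𝓘(ℝ, E') 𝓘(ℝ, E) ∞ f)
    (hft : g.IsTimelike (E' := E') f)
    (hdim : 2 ≤ Module.finrank ℝ E') (hdim' : Module.finrank ℝ E' ≤ Module.finrank ℝ E) :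
    g.IsTotallyUmbilic (E' := E') f ↔ g.IsPhotonSurface (E' := E') f :=
  ⟨fun h ↦ h.isPhotonSurface hf hft, fun h ↦ h.isTotallyUmbilic hf hft⟩
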